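/- Let $n\ge 2$ and let $(N^{2n+1},\varphi,\xi,\eta,g)$ be a smooth Sasakian space form of constant $\varphi$-sectional curvature $c\neq 1$. That is: $\varphi$ is a $(1,1)$-tensor field, $\xi$ a vector field and $\eta$ a 1-form with $\varphi^2=-I+\eta\otimes\xi$ and $\eta(\xi)=1$; $g$ is a Riemannian metric with Levi-Civita connection $\nabla$ such that $g(\varphi X,\varphi Y)=g(X,Y)-\eta(X)\eta(Y)$, $g(X,\varphi Y)=d\eta(X,Y)$ (where $2\,d\eta(X,Y)=X\eta(Y)-Y\eta(X)-\eta([X,Y])$) and $(\nabla_X\varphi)Y=g(X,Y)\xi-\eta(Y)X$; and for every unit vector $X\perp\xi$ the plane spanned by $X$ and $\varphi X$ has sectional curvature $c$. Let $J\subset\mathbb R$ be an open interval and let $\gamma:J\to N$ be a smooth unit-speed Frenet curve of osculating order $r$, $1\le r\le 2n+1$: there are orthonormal vector fields $E_1=T=\gamma',E_2,\dots,E_r$ along $\gamma$ and positive functions $\kappa_1,\dots,\kappa_{r-1}$ on $J$ with $\nabla_TE_i=-\kappa_{i-1}E_{i-1}+\kappa_iE_{i+1}$ for $1\le i\le r$,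 where the terms containing $E_0$ and $E_{r+1}$ are omitted. A circle is such a curve with $r=2$ and $\kappa_1$ constant; a helix is such a curve with $r=3$ and $\kappa_1,\kappa_2$ constant. The curve $\gamma$ is called proper-biharmonic if its bitension field $\tau_2(\gamma)=\nabla_T^3T-R(T,\nabla_TT)T$ vanishes identically on $J$, where $R(X,Y)Z=\nabla_X\nabla_YZ-\nabla_Y\nabla_XZ-\nabla_{[X,Y]}Z$, while $\nabla_TT$ does not vanish identically. Assume that $\gamma$ is not a Legendre curve, i.e. the function $\eta(T)$ is not identically zero, and that $\nabla_TT\perp\varphi T$ along $\gamma$. The function $\eta(T)$ is not assumed to be constant. Then $\gamma$ is proper-biharmonic if and only if there is a constant $\beta_0\in(0,2\pi)\setminus\{\frac{\pi}{2},\pi,\frac{3\pi}{2}\}$ with $\frac{c+3}{4}-\frac{c-1}{4}\cos^2\beta_0>0$ such that $\eta(T)=\cos\beta_0$ on $J$ and either a) $\gamma$ is a circle with $\kappa_1^2=\frac{c+3}{4}-\frac{c-1}{4}\cos^2\beta_0$, or b) $\gamma$ is a helix with $\kappa_1^2+\kappa_2^2=\frac{c+3}{4}-\frac{c-1}{4}\cos^2\beta_0$.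 -/

import Mathlib

open Bundle Set
open scoped Manifold ContDiff Bundle

noncomputable section

namespace Sasaki

variable {E : Type*} [NormedAddCommGroup E] [NormedSpace ℝ E] [FiniteDimensional ℝ E]
  [CompleteSpace E]
  {H : Type*} [TopologicalSpace H] {I : ModelWithCorners ℝ E H}
  {M : Type*} [TopologicalSpace M] [ChartedSpace H M] [IsManifold I ∞ M]

/-- `conn` is the (smooth) Levi-Civita connection of the Riemannian metric on the tangent bundle:
the torsion-free connection compatible with the metric. In Mathlib's notation
`conn Y x v` is `∇_v Y` at `x`. -/
structure IsLeviCivita [RiemannianBundle (fun x : M ↦ TangentSpace I x)]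
    (conn : CovariantDerivative I E (TangentSpace I : M → Type _)) : Prop where
  smooth : CovariantDerivative.ContMDiffCovariantDerivative conn ∞
  torsion_free : conn.torsion = 0
  metric : ∀ (x : M) (u : TangentSpace I x) (Y Z : Π x : M, TangentSpace I x),
    MDiffAt (T% Y) x → MDiffAt (T% Z) x →
      mvfderiv I (fun y ↦ (inner ℝ (Y y) (Z y) : ℝ)) x u
        = inner ℝ (conn Y x u) (Z x) + inner ℝ (Y x) (conn Z x u)

/-- The curvature on vector fields,
`R(X,Y)Z = ∇_X ∇_Y Z - ∇_Y ∇_X Z - ∇_{[X,Y]} Z`. -/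
def curvatureField (conn : CovariantDerivative I E (TangentSpace I : M → Type _))
    (X Y Z : Π x : M, TangentSpace I x) (x : M) : TangentSpace I x :=
  conn (fun y ↦ conn Z y (Y y)) x (X x) - conn (fun y ↦ conn Z y (X y)) x (Y x)
    - conn Z x (VectorField.mlieBracket I X Y x)

/-- The curvature tensor `R(u,v)w` at the point `x`, computed on local extensions of the vectors
`u, v, w` (the ones with constant components in the preferred chart at `x`). -/
def curvature (conn : CovariantDerivative I E (TangentSpace I : M → Type _)) (x : M)
    (u v w : TangentSpace I x) : TangentSpace I x :=
  curvatureField conn (FiberBundle.extend E u) (FiberBundle.extend E v)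
    (FiberBundle.extend E w) x

/-- The sectional curvature of the plane spanned by `u` and `v`. -/
def sectionalCurvature [RiemannianBundle (fun x : M ↦ TangentSpace I x)]
    (conn : CovariantDerivative I E (TangentSpace I : M → Type _)) (x : M)
    (u v : TangentSpace I x) : ℝ :=
  inner ℝ (curvature conn x u v v) u
    / (inner ℝ u u * inner ℝ v v - (inner ℝ u v) ^ 2)

/-- The exterior derivative of a one-form, with the normalization
`dη(X,Y) = (X η(Y) - Y η(X) - η([X,Y])) / 2` customary in contact metric geometry. -/
def extDerivOneForm (η : Π x : M, TangentSpace I x →L[ℝ] ℝ)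
    (X Y : Π x : M, TangentSpace I x) (x : M) : ℝ :=
  (mvfderiv I (fun y ↦ η y (Y y)) x (X x) - mvfderiv I (fun y ↦ η y (X y)) x (Y x)
    - η x (VectorField.mlieBracket I X Y x)) / 2

/-- `(φ, ξ, η)` together with the Riemannian metric is a contact metric structure. -/
structure IsContactMetric [RiemannianBundle (fun x : M ↦ TangentSpace I x)]
    (φ : Π x : M, TangentSpace I x →L[ℝ] TangentSpace I x) (ξ : Π x : M, TangentSpace I x)
    (η : Π x : M, TangentSpace I x →L[ℝ] ℝ) : Prop where
  smooth_φ : ContMDiff I (I.prod 𝓘(ℝ, E →L[ℝ] E)) ∞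
    (fun x ↦ TotalSpace.mk' (E →L[ℝ] E) (E := fun x : M ↦ TangentSpace I x →L[ℝ] TangentSpace I x)
      x (φ x))
  smooth_ξ : ContMDiff I (I.prod 𝓘(ℝ, E)) ∞
    (fun x ↦ TotalSpace.mk' E (E := fun x : M ↦ TangentSpace I x) x (ξ x))
  smooth_η : ContMDiff I (I.prod 𝓘(ℝ, E →L[ℝ] ℝ)) ∞
    (fun x ↦ TotalSpace.mk' (E →L[ℝ] ℝ) (E := fun x : M ↦ TangentSpace I x →L[ℝ] ℝ)
      x (η x))
  φ_sq : ∀ (x : M) (u : TangentSpace I x), φ x (φ x u) = -u + η x u • ξ x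
  η_ξ : ∀ x : M, η x (ξ x) = 1
  inner_φ : ∀ (x : M) (u v : TangentSpace I x),
    inner ℝ (φ x u) (φ x v) = inner ℝ u v - η x u * η x v
  contact : ∀ (x : M) (X Y : Π x : M, TangentSpace I x),
    MDiffAt (T% X) x → MDiffAt (T% Y) x →
      inner ℝ (X x) (φ x (Y x)) = extDerivOneForm η X Y x

/-- A contact metric structure is Sasakian if `(∇_X φ) Y = g(X,Y) ξ - η(Y) X`, where
`(∇_X φ) Y = ∇_X (φ Y) - φ (∇_X Y)`. -/
structure IsSasakian [RiemannianBundle (fun x : M ↦ TangentSpace I x)]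
    (conn : CovariantDerivative I E (TangentSpace I : M → Type _))
    (φ : Π x : M, TangentSpace I x →L[ℝ] TangentSpace I x) (ξ : Π x : M, TangentSpace I x)
    (η : Π x : M, TangentSpace I x →L[ℝ] ℝ) : Prop extends IsContactMetric φ ξ η where
  nabla_φ : ∀ (x : M) (u : TangentSpace I x) (Y : Π x : M, TangentSpace I x),
    MDiffAt (T% Y) x →
      conn (fun y ↦ φ y (Y y)) x u - φ x (conn Y x u) = inner ℝ u (Y x) • ξ x - η x (Y x) • u

/-- A Sasakian space form: a Sasakian manifold with constant `φ`-sectional curvature `c`. -/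
structure IsSasakianSpaceForm [RiemannianBundle (fun x : M ↦ TangentSpace I x)]
    (conn : CovariantDerivative I E (TangentSpace I : M → Type _))
    (φ : Π x : M, TangentSpace I x →L[ℝ] TangentSpace I x) (ξ : Π x : M, TangentSpace I x)
    (η : Π x : M, TangentSpace I x →L[ℝ] ℝ) (c : ℝ) : Prop extends IsSasakian conn φ ξ η where
  sectional : ∀ (x : M) (u : TangentSpace I x), inner ℝ u u = (1 : ℝ) → inner ℝ u (ξ x) = (0 : ℝ) →
    sectionalCurvature conn x u (φ x u) = c

/-- The velocity vector field `γ'` of a curve. -/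
def velocity (I : ModelWithCorners ℝ E H) (γ : ℝ → M) (t : ℝ) : TangentSpace I (γ t) :=
  mfderiv 𝓘(ℝ, ℝ) I γ t (1 : ℝ)

/-- The covariant derivative `∇_{γ'} V` of a vector field `V` along `γ`. In the preferred chart at
`γ t` with coordinate fields `∂_i` and `V = ∑ V^i ∂_i`, this is
`∑ (V^i)' ∂_i + ∑ V^i ∇_{γ'} ∂_i`; the second sum is `∇_{γ'}` of the field whose components are the
constants `V^i(t)`. -/
def covDerivAlong (conn : CovariantDerivative I E (TangentSpace I : M → Type _)) (γ : ℝ → M)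
    (V : Π t : ℝ, TangentSpace I (γ t)) (t : ℝ) : TangentSpace I (γ t) :=
  (trivializationAt E (TangentSpace I : M → Type _) (γ t)).symm (γ t)
      (deriv (fun s ↦ (trivializationAt E (TangentSpace I : M → Type _) (γ t)
        (TotalSpace.mk' E (γ s) (V s))).2) t)
    + conn (FiberBundle.extend E (V t)) (γ t) (velocity I γ t)

/-- The tension field `τ(γ) = ∇_T T` of a curve `γ`, `T = γ'`. -/
def tension (conn : CovariantDerivative I E (TangentSpace I : M → Type _)) (γ : ℝ → M) (t : ℝ) :
    TangentSpace I (γ t) :=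
  covDerivAlong conn γ (velocity I γ) t

/-- The bitension field `τ₂(γ) = ∇_T ∇_T τ(γ) - R(T, τ(γ)) T` of a curve `γ`. -/
def bitension (conn : CovariantDerivative I E (TangentSpace I : M → Type _)) (γ : ℝ → M) (t : ℝ) :
    TangentSpace I (γ t) :=
  covDerivAlong conn γ (covDerivAlong conn γ (tension conn γ)) t
    - curvature conn (γ t) (velocity I γ t) (tension conn γ t) (velocity I γ t)

/-- `γ` is proper-biharmonic on the interval `J`: biharmonic and not harmonic. -/
def IsProperBiharmonic (conn : CovariantDerivative I E (TangentSpace I : M → Type _)) (γ : ℝ → M)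
    (J : Set ℝ) : Prop :=
  (∀ t ∈ J, bitension conn γ t = 0) ∧ ¬ ∀ t ∈ J, tension conn γ t = 0

/-- `γ`, a smooth curve on the open interval `J`, is a Frenet curve of osculating order `r` with
Frenet frame `F 1, …, F r` and curvatures `κ 1, …, κ (r - 1)`; only these indices and only the
parameters in `J` matter. As `F 1 = γ'` is a unit vector, `γ` is parametrized by arc length. -/
structure IsFrenetCurve [RiemannianBundle (fun x : M ↦ TangentSpace I x)]
    (conn : CovariantDerivative I E (TangentSpace I : M → Type _)) (γ : ℝ → M) (J : Set ℝ)
    (r : ℕ) (F : ℕ → Π t : ℝ, TangentSpace I (γ t)) (κ : ℕ → ℝ → ℝ) : Prop where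
  smooth_curve : ContMDiffOn 𝓘(ℝ, ℝ) I ∞ γ J
  one_le : 1 ≤ r
  le_dim : r ≤ Module.finrank ℝ E
  smooth_frame : ∀ i ∈ Icc 1 r, ContMDiffOn 𝓘(ℝ, ℝ) (I.prod 𝓘(ℝ, E)) ∞
    (fun t ↦ TotalSpace.mk' E (E := fun x : M ↦ TangentSpace I x) (γ t) (F i t)) J
  orthonormal : ∀ t ∈ J, ∀ i ∈ Icc 1 r, ∀ j ∈ Icc 1 r,
    inner ℝ (F i t) (F j t) = if i = j then (1 : ℝ) else 0
  tangent : ∀ t ∈ J, F 1 t = velocity I γ t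
  curvature_pos : ∀ i, 1 ≤ i → i < r → ∀ t ∈ J, 0 < κ i t
  frenet : ∀ t ∈ J, ∀ i ∈ Icc 1 r,
    covDerivAlong conn γ (F i) t
      = (if i = 1 then 0 else -(κ (i - 1) t • F (i - 1) t))
        + (if i = r then 0 else κ i t • F (i + 1) t)

/-- A Frenet curve of osculating order `2` with constant first curvature. -/
def IsCircle (J : Set ℝ) (r : ℕ) (κ : ℕ → ℝ → ℝ) : Prop :=
  r = 2 ∧ ∃ k₁ : ℝ, ∀ t ∈ J, κ 1 t = k₁

/-- A Frenet curve of osculating order `3` with constant curvatures. -/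
def IsHelix (J : Set ℝ) (r : ℕ) (κ : ℕ → ℝ → ℝ) : Prop :=
  r = 3 ∧ ∃ k₁ k₂ : ℝ, ∀ t ∈ J, κ 1 t = k₁ ∧ κ 2 t = k₂

end Sasaki

end

/-! Write `T` for the velocity, `P` for the second Frenet field, `k = κ 1`, and `B` for the part of
`∇_T P` orthogonal to `T`: zero if `r = 2`, and `κ 2 • F 3` otherwise. Leaving `B` unnormalized
treats all orders at once. Put `f = ⟨T,ξ⟩ = η(T)`, `a = ⟨P,ξ⟩`, `b = ⟨B,ξ⟩`, `n = |B|²`, `C =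
(c-1)/4`.

The curvature of a Sasakian space form is an explicit tensor
(`IsSasakianSpaceForm.inner_curvature`). Since `P ⊥ φT`, it gives `R(T,P)T = (-(C+1) + C f²) P + C a
(ξ - f T)`. The `T`-component of the biharmonic equation is `k k' = 0`, so `k' = 0`. The
`P`-component is `k² + n + C f² + C a² = C + 1`, and what remains determines `∇_T B`.

The main point is that `f` must be constant. From `∇ξ = -φ` and the derivative of `⟨P,φT⟩ = 0` one
gets `f' = k a`, `a' = -k f + b`, `b' = a (C + 1 - n - C f² - C a²)`, `n' = 2 C a b`.
Differentiating the `P`-equation gives `4 C a b = 0`, so `a b = 0` because `c ≠ 1`. Where `a ≠ 0`,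
`b` vanishes nearby, and then `b' = 0` and the `P`-equation give `k² = 0`, which is impossible
(`normal_component_eq_zero`). So `a = 0`, `f` is constant and `∇_T B = -n P`. Hence `n` is constant,
and for `r ≥ 3` there is no fourth Frenet field and `κ 2` is constant. Finally `f² < 1`, so `β₀ =
arccos f` is admissible.

Conversely, constant `f` forces `a = 0` through `f' = k a`, and the bitension field reduces to a
multiple of `P` whose coefficient is the stated equation. -/

noncomputable section
set_option linter.unusedSectionVars false

namespace Sasaki

/-! ### Smooth vector fields, the Levi-Civita connection and symmetries of its curvature. -/

section fields

open FiberBundle VectorField Filter Topology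

variable {E : Type*} [NormedAddCommGroup E] [NormedSpace ℝ E] [FiniteDimensional ℝ E]
  [CompleteSpace E]
  {H : Type*} [TopologicalSpace H] {I : ModelWithCorners ℝ E H}
  {M : Type*} [TopologicalSpace M] [ChartedSpace H M] [IsManifold I ∞ M]

/-- Every tangent vector extends to a smooth global field which near the base point has constant
components in the preferred chart. -/
lemma exists_smooth_extend [T2Space M] (x : M) : ∃ s ∈ 𝓝 x, IsOpen s ∧
    ∀ v : TangentSpace I x, ∃ X : Π y : M, TangentSpace I y,
      CMDiff ∞ (T% X) ∧ X x = v ∧ ∀ y ∈ s, X y = extend E v y := by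
  let t := trivializationAt E (TangentSpace I : M → Type _) x
  have hx : t.baseSet ∈ 𝓝 x := t.open_baseSet.mem_nhds (mem_baseSet_trivializationAt' x)
  obtain ⟨f, hf, hf'⟩ := (SmoothBumpFunction.nhds_basis_tsupport (I := I) x).mem_iff.1 hx
  obtain ⟨s, hs, hso, hxs⟩ := mem_nhds_iff.1 f.eventuallyEq_one
  refine ⟨s, hso.mem_nhds hxs, hso, fun v ↦ ⟨(f : M → ℝ) • (extend E v), ?_, by simp, ?_⟩⟩
  · refine ContMDiffOn.smul_section_of_tsupport (u := t.baseSet) f.contMDiff.contMDiffOn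
      t.open_baseSet hf' ?_
    intro y hy
    rw [t.contMDiffWithinAt_section _ hy]
    have : CMDiff[t.baseSet] ∞ (fun (_ : M) ↦ (t ⟨x, v⟩).2) := contMDiffOn_const
    exact this.congr (fun z hz ↦ by
      have hz' : z ∈ (trivializationAt E (TangentSpace I : M → Type _) x).baseSet := hz
      simp only [extend, t]
      rw [Trivialization.apply_mk_symm _ hz']) y hy
  · intro y hy
    have : f y = 1 := hs hy
    simp [this]

variable {conn : CovariantDerivative I E (TangentSpace I : M → Type _)}

lemma smooth_conn (hconn : CovariantDerivative.ContMDiffCovariantDerivative conn ∞)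
    {X Y : Π x : M, TangentSpace I x} (hX : CMDiff ∞ (T% X)) (hY : CMDiff ∞ (T% Y)) :
    CMDiff ∞ (T% (fun y ↦ conn Y y (X y))) := by
  have := hconn.contMDiff.contMDiff (σ := Y) hY.contMDiffOn
  rw [contMDiffOn_univ] at this
  exact this.clm_bundle_apply hX

lemma smooth_mvfderiv {g : M → ℝ} (hg : CMDiff ∞ g)
    {X : Π x : M, TangentSpace I x} (hX : CMDiff ∞ (T% X)) :
    CMDiff ∞ (fun y ↦ mvfderiv I g y (X y)) := by
  have h1 : ContMDiff I.tangent 𝓘(ℝ, ℝ).tangent ∞ (tangentMap I 𝓘(ℝ, ℝ) g) :=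
    hg.contMDiff_tangentMap (by simp)
  exact (contMDiff_snd_tangentBundle_modelSpace ℝ 𝓘(ℝ, ℝ)).comp (h1.comp hX)

/-- Compare the Jacobi identity for `X, Y, g • Z` with the one for `X, Y, Z`. By the Leibniz rule
for brackets, everything cancels except a multiple of `Z x`, whose coefficient is the difference of
the two sides. A `Z` with `Z x ≠ 0` exists unless the tangent space is trivial. -/
lemma mvfderiv_mlieBracket [T2Space M] {g : M → ℝ} (hg : CMDiff ∞ g)
    {X Y : Π x : M, TangentSpace I x} (hX : CMDiff ∞ (T% X)) (hY : CMDiff ∞ (T% Y)) (x : M) :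
    mvfderiv I g x (mlieBracket I X Y x) =
      mvfderiv I (fun y ↦ mvfderiv I g y (Y y)) x (X x)
       - mvfderiv I (fun y ↦ mvfderiv I g y (X y)) x (Y x) := by
  rcases subsingleton_or_nontrivial E with hE | hE
  · have : Subsingleton (TangentSpace I x) := hE
    simp [Subsingleton.elim (mlieBracket I X Y x) 0, Subsingleton.elim (X x) 0,
      Subsingleton.elim (Y x) 0]
  have : IsManifold I (minSmoothness ℝ 3) M := by
    rw [minSmoothness_of_isRCLikeNormedField]; infer_instance
  have : IsManifold I (minSmoothness ℝ 2) M := by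
    rw [minSmoothness_of_isRCLikeNormedField]; infer_instance
  have : IsManifold I (((⊤ : ℕ∞) : WithTop ℕ∞) + 1) M := inferInstanceAs (IsManifold I ∞ M)
  obtain ⟨v, hv⟩ : ∃ v : TangentSpace I x, v ≠ 0 := exists_ne (α := E) 0
  obtain ⟨s, -, -, h⟩ := exists_smooth_extend (I := I) x
  obtain ⟨Z, hZ, rfl, -⟩ := h v
  have e : ∀ {W : Π x : M, TangentSpace I x}, CMDiff ∞ (T% W) → ∀ y, MDiffAt (T% W) y :=
    fun hW y ↦ hW.mdifferentiable (by simp) y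
  have e' : ∀ {W : M → ℝ}, CMDiff ∞ W → ∀ y, MDiffAt W y :=
    fun hW y ↦ hW.mdifferentiable (by simp) y
  have br : ∀ {V W : Π x : M, TangentSpace I x}, CMDiff ∞ (T% V) → CMDiff ∞ (T% W) →
      CMDiff ∞ (T% (mlieBracket I V W)) := fun hV hW ↦
    ContDiff.mlieBracket_vectorField (m := ⊤) (n := ⊤) hV hW (by simp)
  have h2 : ∀ {W : Π x : M, TangentSpace I x}, CMDiff ∞ (T% W) → 
      CMDiffAt (minSmoothness ℝ 2) (T% W) x := fun hW ↦
    (hW.of_le (by rw [minSmoothness_of_isRCLikeNormedField]; exact ENat.LEInfty.out)).contMDiffAt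
  have key : ∀ {V W : Π x : M, TangentSpace I x}, CMDiff ∞ (T% V) → CMDiff ∞ (T% W) →
      mlieBracket I V (mlieBracket I W (g • Z)) x =
       mvfderiv I (fun y ↦ mvfderiv I g y (W y)) x (V x) • Z x
        + mvfderiv I g x (W x) • mlieBracket I V Z x 
        + mvfderiv I g x (V x) • mlieBracket I W Z x + g x • mlieBracket I V (mlieBracket I W Z) x := by
    intro V W hV hW
    have : mlieBracket I W (g • Z) = (fun y ↦ mvfderiv I g y (W y)) • Z + g • mlieBracket I W Z := by
      ext y
      rw [mlieBracket_smul_right (e' hg y) (e hZ y)]; rfl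
    rw [this, mlieBracket_add_right, mlieBracket_smul_right, mlieBracket_smul_right]
    · simp only [add_assoc]
    · exact e' hg x
    · exact e (br hW hZ) x
    · exact e' (smooth_mvfderiv hg hW) x
    · exact e hZ x
    · exact e ((smooth_mvfderiv hg hW).smul_section hZ) x
    · exact e (hg.smul_section (br hW hZ)) x
  have j1 := leibniz_identity_mlieBracket_apply (h2 hX) (h2 hY) (h2 hZ)
  have j2 := leibniz_identity_mlieBracket_apply (h2 hX) (h2 hY) (h2 (hg.smul_section hZ))
  have : mlieBracket I (mlieBracket I X Y) (g • Z) x = _ :=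
    mlieBracket_smul_right (e' hg x) (e hZ x)
  rw [key hX hY, key hY hX, this, j1] at j2
  have : (mvfderiv I g x (mlieBracket I X Y x) -
      (mvfderiv I (fun y ↦ mvfderiv I g y (Y y)) x (X x)
       - mvfderiv I (fun y ↦ mvfderiv I g y (X y)) x (Y x))) • Z x = 0 := by
    rw [← sub_eq_zero] at j2
    rw [← neg_eq_zero, ← j2]
    module
  exact sub_eq_zero.1 ((smul_eq_zero.1 this).resolve_right hv)

variable {X Y Z W : Π x : M, TangentSpace I x} {x : M}

lemma mdiffAt_of_smooth (hX : CMDiff ∞ (T% X)) : MDiffAt (T% X) x :=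
  hX.mdifferentiable (by simp) x

lemma conn_fun_add (hX : CMDiff ∞ (T% X)) (hY : CMDiff ∞ (T% Y)) :
    conn (fun y ↦ X y + Y y) x = conn X x + conn Y x :=
  conn.isCovariantDerivativeOn.add (s := univ) (mdiffAt_of_smooth hX) (mdiffAt_of_smooth hY)

lemma conn_fun_smul {g : M → ℝ} (hg : CMDiff ∞ g) (hX : CMDiff ∞ (T% X)) :
    conn (fun y ↦ g y • X y) x = g x • conn X x + (mvfderiv I g x).smulRight (X x) :=
  conn.isCovariantDerivativeOn.leibniz (s := univ) (mdiffAt_of_smooth hX)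
    (hg.mdifferentiable (by simp) x)

lemma conn_fun_const_smul (a : ℝ) (hX : CMDiff ∞ (T% X)) :
    conn (fun y ↦ a • X y) x = a • conn X x :=
  conn.isCovariantDerivativeOn.smul_const (s := univ) a (mdiffAt_of_smooth hX)

lemma smooth_fun_sub (hX : CMDiff ∞ (T% X)) (hY : CMDiff ∞ (T% Y)) :
    CMDiff ∞ (T% (fun y ↦ X y - Y y)) := hX.sub_section hY

lemma smooth_fun_smul {g : M → ℝ} (hg : CMDiff ∞ g) (hX : CMDiff ∞ (T% X)) :
    CMDiff ∞ (T% (fun y ↦ g y • X y)) := hg.smul_section hX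

lemma smooth_fun_const_smul (a : ℝ) (hX : CMDiff ∞ (T% X)) :
    CMDiff ∞ (T% (fun y ↦ a • X y)) := smooth_fun_smul contMDiff_const hX

lemma conn_fun_sub (hX : CMDiff ∞ (T% X)) (hY : CMDiff ∞ (T% Y)) :
    conn (fun y ↦ X y - Y y) x = conn X x - conn Y x := by
  have : (fun y ↦ X y - Y y) = fun y ↦ X y + (-1 : ℝ) • Y y := by
    ext y; simp [sub_eq_add_neg]
  rw [this, conn_fun_add hX (smooth_fun_const_smul _ hY), conn_fun_const_smul _ hY]
  simp [sub_eq_add_neg]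

lemma smooth_mlieBracket (hX : CMDiff ∞ (T% X)) (hY : CMDiff ∞ (T% Y)) :
    CMDiff ∞ (T% (mlieBracket I X Y)) := by
  have : IsManifold I (minSmoothness ℝ 2) M := by
    rw [minSmoothness_of_isRCLikeNormedField]; infer_instance
  have : IsManifold I (((⊤ : ℕ∞) : WithTop ℕ∞) + 1) M := inferInstanceAs (IsManifold I ∞ M)
  exact ContDiff.mlieBracket_vectorField (m := ⊤) (n := ⊤) hX hY (by simp)

lemma curvatureField_swap :
    curvatureField conn X Y Z x = - curvatureField conn Y X Z x := by
  rw [curvatureField, curvatureField, mlieBracket_swap_apply, map_neg]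
  module

lemma smooth_inner [RiemannianBundle (fun x : M ↦ TangentSpace I x)]
    [IsContMDiffRiemannianBundle I ∞ E (fun x : M ↦ TangentSpace I x)]
    (hX : CMDiff ∞ (T% X)) (hY : CMDiff ∞ (T% Y)) :
    CMDiff ∞ (fun y ↦ (inner ℝ (X y) (Y y) : ℝ)) :=
  ContMDiff.inner_bundle (IB := I) (n := ∞) (F := E) (E := fun x : M ↦ TangentSpace I x)
    (b := fun x ↦ x) hX hY

section curvature

variable [T2Space M] [RiemannianBundle (fun x : M ↦ TangentSpace I x)]
    [IsContMDiffRiemannianBundle I ∞ E (fun x : M ↦ TangentSpace I x)]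
    (hc : IsLeviCivita conn)

include hc

lemma IsLeviCivita.mlieBracket (hX : CMDiff ∞ (T% X)) (hY : CMDiff ∞ (T% Y)) :
    mlieBracket I X Y x = conn Y x (X x) - conn X x (Y x) :=
  ((CovariantDerivative.torsion_eq_zero_iff conn).1 hc.torsion_free
    (mdiffAt_of_smooth hX) (mdiffAt_of_smooth hY)).symm

/-- Metric compatibility, used twice, expands `X(Y⟨Z,W⟩)`. Antisymmetrizing in `X, Y` cancels the
mixed terms, and subtracting `[X,Y]⟨Z,W⟩` leaves the two curvature terms, with sum zero. -/
lemma IsLeviCivita.inner_curvatureField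
    (hX : CMDiff ∞ (T% X)) (hY : CMDiff ∞ (T% Y)) (hZ : CMDiff ∞ (T% Z)) (hW : CMDiff ∞ (T% W)) :
    inner ℝ (curvatureField conn X Y Z x) (W x)
      = - (inner ℝ (Z x) (curvatureField conn X Y W x) : ℝ) := by
  have h1 : ∀ {X Y : Π x : M, TangentSpace I x}, CMDiff ∞ (T% X) → CMDiff ∞ (T% Y) →
      mvfderiv I (fun y ↦ mvfderiv I (fun y ↦ (inner ℝ (Z y) (W y) : ℝ)) y (Y y)) x (X x)
      = inner ℝ (conn (fun y ↦ conn Z y (Y y)) x (X x)) (W x)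
        + inner ℝ (conn Z x (Y x)) (conn W x (X x))
        + (inner ℝ (conn Z x (X x)) (conn W x (Y x))
        + inner ℝ (Z x) (conn (fun y ↦ conn W y (Y y)) x (X x))) := by
    intro X Y hX hY
    have : (fun y ↦ mvfderiv I (fun y ↦ (inner ℝ (Z y) (W y) : ℝ)) y (Y y)) = fun y ↦
        (inner ℝ (conn Z y (Y y)) (W y) : ℝ) + (inner ℝ (Z y) (conn W y (Y y)) : ℝ) := by
      ext y
      rw [hc.metric y (Y y) Z W (mdiffAt_of_smooth hZ) (mdiffAt_of_smooth hW)]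
    have hYZ := smooth_conn hc.smooth hY hZ
    have hYW := smooth_conn hc.smooth hY hW
    rw [this, mvfderiv_fun_add ((smooth_inner hYZ hW).mdifferentiable (by simp) x)
      ((smooth_inner hZ hYW).mdifferentiable (by simp) x), add_apply,
      hc.metric x (X x) _ W (mdiffAt_of_smooth hYZ) (mdiffAt_of_smooth hW),
      hc.metric x (X x) Z _ (mdiffAt_of_smooth hZ) (mdiffAt_of_smooth hYW)]
  have h2 := mvfderiv_mlieBracket (smooth_inner hZ hW) hX hY x
  rw [h1 hX hY, h1 hY hX, hc.metric x _ Z W (mdiffAt_of_smooth hZ) (mdiffAt_of_smooth hW)] at h2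
  simp only [curvatureField, inner_sub_left, inner_sub_right]
  linarith

/-- For a torsion-free connection this is the Jacobi identity, with every bracket replaced by a
difference of covariant derivatives. -/
lemma IsLeviCivita.bianchi_curvatureField
    (hX : CMDiff ∞ (T% X)) (hY : CMDiff ∞ (T% Y)) (hZ : CMDiff ∞ (T% Z)) :
    curvatureField conn X Y Z x + curvatureField conn Y Z X x + curvatureField conn Z X Y x = 0 := by
  have : IsManifold I (minSmoothness ℝ 3) M := by
    rw [minSmoothness_of_isRCLikeNormedField]; infer_instance
  have h2 : ∀ {W : Π x : M, TangentSpace I x}, CMDiff ∞ (T% W) →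
      CMDiffAt (minSmoothness ℝ 2) (T% W) x := fun hW ↦
    (hW.of_le (by rw [minSmoothness_of_isRCLikeNormedField]; exact ENat.LEInfty.out)).contMDiffAt
  have br : ∀ {X Y Z : Π x : M, TangentSpace I x}, CMDiff ∞ (T% X) → CMDiff ∞ (T% Y) →
      CMDiff ∞ (T% Z) → VectorField.mlieBracket I X (VectorField.mlieBracket I Y Z) x
        = conn (fun y ↦ conn Z y (Y y)) x (X x) - conn (fun y ↦ conn Y y (Z y)) x (X x)
          - conn X x (VectorField.mlieBracket I Y Z x) := by
    intro X Y Z hX hY hZ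
    rw [hc.mlieBracket hX (smooth_mlieBracket hY hZ)]
    have : VectorField.mlieBracket I Y Z = fun y ↦ conn Z y (Y y) - conn Y y (Z y) := by
      ext y; exact hc.mlieBracket hY hZ
    conv_lhs => enter [1]; rw [this]
    rw [conn_fun_sub (smooth_conn hc.smooth hY hZ) (smooth_conn hc.smooth hZ hY)]
    rfl
  have j := leibniz_identity_mlieBracket_apply (h2 hX) (h2 hY) (h2 hZ)
  rw [mlieBracket_swap_apply (V := VectorField.mlieBracket I X Y), mlieBracket_swap (V := X) (W := Z),
    br hX hY hZ, br hZ hX hY] at j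
  have e : VectorField.mlieBracket I Y (-VectorField.mlieBracket I Z X) x
      = - VectorField.mlieBracket I Y (VectorField.mlieBracket I Z X) x := by
    have := mlieBracket_const_smul_right (V := Y) (c := (-1 : ℝ))
      (mdiffAt_of_smooth (x := x) (smooth_mlieBracket hZ hX))
    simpa using this
  rw [e, br hY hZ hX] at j
  simp only [curvatureField]
  rw [← sub_eq_zero] at j
  rw [← j]
  module

end curvature

end fields

/-! ### Algebraic curvature tensors and the model tensor of a Sasakian space form. -/

section algebra

/-- The pair symmetry of a form with the symmetries of a curvature tensor. -/
lemma curvature_pair_symm {V : Type*} (B : V → V → V → V → ℝ)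
    (anti : ∀ u v w z, B u v w z = - B v u w z)
    (skew : ∀ u v w z, B u v w z = - B u v z w)
    (bianchi : ∀ u v w z, B u v w z + B v w u z + B w u v z = 0) (u v w z : V) :
    B u v w z = B w z u v := by
  -- The octahedron argument: combine the Bianchi identities on the four cyclic shifts of `(u, v, w,
  -- z)`.
  have h1 := bianchi u v w z
  have h2 := bianchi v w z u
  have h3 := bianchi w z u v
  have h4 := bianchi z u v w
  linarith [skew u v w z, skew v w u z, skew w u v z, skew v w z u, skew w z v u, skew z v w u,
    skew w z u v, skew z u w v, skew u w z v, skew z u v w, skew u v z w, skew v z u w,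
    anti u v w z, anti v w u z, anti w u v z, anti v w z u, anti w z v u, anti z v w u,
    anti w z u v, anti z u w v, anti u w z v, anti z u v w, anti u v z w, anti v z u w,
    anti u w v z, anti v z w u, anti u w v z]

/-- A quadrilinear form with the symmetries of a Kähler curvature tensor vanishes if its holomorphic
sectional curvature does. -/
lemma kaehler_curvature_eq_zero {V : Type*} [AddCommGroup V] (B : V → V → V → V → ℝ) (J : V → V)
    (hJ : ∀ u v, J (u + v) = J u + J v)
    (add4 : ∀ u v w z z', B u v w (z + z') = B u v w z + B u v w z')
    (anti : ∀ u v w z, B u v w z = - B v u w z)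
    (skew : ∀ u v w z, B u v w z = - B u v z w)
    (bianchi : ∀ u v w z, B u v w z + B v w u z + B w u v z = 0)
    (BJ : ∀ u v w z, B u v (J w) z = - B u v w (J z))
    (BJJ : ∀ u v w z, B u v w (J (J z)) = - B u v w z)
    (hol : ∀ u, B u (J u) (J u) u = 0) (u v w z : V) : B u v w z = 0 := by
  have pair := curvature_pair_symm B anti skew bianchi
  have add3 : ∀ u v w w' z, B u v (w + w') z = B u v w z + B u v w' z := by
    intro u v w w' z
    rw [skew, add4, skew u v w, skew u v w']; ring
  have add1 : ∀ u u' v w z, B (u + u') v w z = B u v w z + B u' v w z := by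
    intro u u' v w z
    rw [pair, add3, pair w, pair w]
  have add2 : ∀ u v v' w z, B u (v + v') w z = B u v w z + B u v' w z := by
    intro u v v' w z
    rw [pair, add4, pair w, pair w]
  have zero4 : ∀ u v w, B u v w 0 = 0 := fun u v w ↦ by simpa using add4 u v w 0 0
  have neg4 : ∀ u v w z, B u v w (-z) = - B u v w z := fun u v w z ↦ by
    have := add4 u v w z (-z)
    rw [add_neg_cancel, zero4] at this
    linarith
  have neg3 : ∀ u v w z, B u v (-w) z = - B u v w z := fun u v w z ↦ by
    rw [skew, neg4, skew u v w]
  have neg1 : ∀ u v w z, B (-u) v w z = - B u v w z := fun u v w z ↦ by rw [pair, neg3, pair w]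
  have neg2 : ∀ u v w z, B u (-v) w z = - B u v w z := fun u v w z ↦ by rw [pair, neg4, pair w]
  have J0 : J 0 = 0 := by simpa using hJ 0 0
  have Jneg : ∀ u, J (-u) = - J u := fun u ↦ by
    have := hJ u (-u)
    rw [add_neg_cancel, J0] at this
    exact (neg_eq_of_add_eq_zero_right this.symm).symm
  have JJ : ∀ u v w z, B u v (J w) (J z) = B u v w z := fun u v w z ↦ by rw [BJ, BJJ, neg_neg]
  have JJ' : ∀ u v w z, B (J u) (J v) w z = B u v w z := fun u v w z ↦ by rw [pair, JJ, pair]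
  -- Polarization: add the vanishing at `X + Y` and at `X - Y`, so that only terms with two `X`s and
  -- two `Y`s survive, and reduce these to two kinds by the symmetries.
  have main : ∀ X Y, B X Y Y X + 3 * B X (J Y) (J Y) X = 0 := by
    intro X Y
    have e1 := hol (X + Y)
    have e2 := hol (X + -Y)
    have e3 := hol X
    have e4 := hol Y
    simp only [hJ, Jneg, add1, add2, add3, add4, neg1, neg2, neg3, neg4] at e1 e2
    have r1 : B Y (J Y) (J X) X = B X (J X) (J Y) Y := by
      rw [pair, anti, skew, neg_neg]
    have r2 : B Y (J X) (J Y) X = B X (J Y) (J X) Y := by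
      rw [pair, anti, skew (X)]; ring
    have s : B X (J Y) (J X) Y = B X (J Y) (J Y) X := by rw [BJ, skew]; ring
    have r3 : B Y (J X) (J X) Y = B X (J Y) (J Y) X := by
      rw [anti, BJ, neg_neg, pair, s]
    have r : B X (J X) (J Y) Y = B X Y Y X + B X (J Y) (J Y) X := by
      have := bianchi X (J X) (J Y) Y
      rw [JJ', anti (J Y), s, skew X Y] at this
      linarith
    linarith
  -- Replacing `Y` by `J Y` in `main` swaps the roles of its two terms; the resulting linear system
  -- is nonsingular.
  have p0 : ∀ X Y, B X Y Y X = 0 := by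
    intro X Y
    have h1 := main X Y
    have h2 := main X (J Y)
    have e : B X (J (J Y)) (J (J Y)) X = B X Y Y X := by
      rw [BJ, JJ, pair, anti, BJJ, skew X Y Y X]; ring
    rw [e] at h2
    linarith
  have p1 : ∀ X Y Z, B X Y Z X = 0 := by
    intro X Y Z
    have h := p0 X (Y + Z)
    rw [add2, add3, add3, p0, p0, pair X Z, anti Y, skew X] at h
    linarith [skew X Y Z X]
  -- Polarizing once more makes `B` alternate in further pairs of slots. The three Bianchi terms
  -- then coincide, so `3 B = 0`.
  have s14 : ∀ X Y Z W, B X Y Z W = - B W Y Z X := by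
    intro X Y Z W
    have h := p1 (X + W) Y Z
    rw [add1, add4, add4, p1, p1] at h
    linarith
  have s13 : ∀ X Y Z W, B X Y Z W = - B Z Y X W := by
    intro X Y Z W
    rw [s14, skew, s14]; ring
  have h := bianchi u v w z
  linarith [s13 v w u z, anti u w v z, s13 w u v z, anti v u w z]

/-- The curvature form of a Sasakian space form. -/
def spaceFormTensor {V : Type*} [NormedAddCommGroup V] [InnerProductSpace ℝ V]
    (φ : V →L[ℝ] V) (ξ : V) (c : ℝ) (u v w z : V) : ℝ :=
  (c + 3) / 4 * (inner ℝ w v * inner ℝ u z - inner ℝ w u * inner ℝ v z)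
  + (c - 1) / 4 * (inner ℝ w ξ * inner ℝ u ξ * inner ℝ v z - inner ℝ w ξ * inner ℝ v ξ * inner ℝ u z
    + inner ℝ w u * inner ℝ v ξ * inner ℝ z ξ - inner ℝ w v * inner ℝ u ξ * inner ℝ z ξ
    + inner ℝ w (φ v) * inner ℝ (φ u) z - inner ℝ w (φ u) * inner ℝ (φ v) z
    + 2 * inner ℝ u (φ v) * inner ℝ (φ w) z)

/-- A tensor with the symmetries of the curvature of a Sasakian manifold is determined by its
`φ`-sectional curvature. -/
theorem inner_eq_spaceFormTensor {V : Type*} [NormedAddCommGroup V] [InnerProductSpace ℝ V]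
    (φ : V →L[ℝ] V) (ξ : V) (c : ℝ) (R : V → V → V → V)
    (φφ : ∀ u, φ (φ u) = -u + (inner ℝ u ξ : ℝ) • ξ)
    (φξ : φ ξ = 0) (ξξ : (inner ℝ ξ ξ : ℝ) = 1)
    (φskew : ∀ u v, (inner ℝ (φ u) v : ℝ) = - inner ℝ u (φ v))
    (anti : ∀ u v w, R u v w = - R v u w)
    (skew : ∀ u v w z, (inner ℝ (R u v w) z : ℝ) = - inner ℝ w (R u v z))
    (bianchi : ∀ u v w, R u v w + R v w u + R w u v = 0)
    (Rξ : ∀ u v, R u v ξ = (inner ℝ v ξ : ℝ) • u - (inner ℝ u ξ : ℝ) • v)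
    (Rφ : ∀ u v w, R u v (φ w) = φ (R u v w) - (inner ℝ v w : ℝ) • φ u + (inner ℝ u w : ℝ) • φ v
      + (inner ℝ w (φ u) : ℝ) • v - (inner ℝ w (φ v) : ℝ) • u)
    (sec : ∀ u, (inner ℝ u ξ : ℝ) = 0 → (inner ℝ u u : ℝ) = 1 →
      (inner ℝ (R u (φ u) (φ u)) u : ℝ) = c) (u v w z : V) :
    inner ℝ (R u v w) z = spaceFormTensor φ ξ c u v w z := by
  have ξφ : ∀ u, (inner ℝ (φ u) ξ : ℝ) = 0 := fun u ↦ by rw [φskew, φξ]; simp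
  have ξφ' : ∀ u, (inner ℝ ξ (φ u) : ℝ) = 0 := fun u ↦ by rw [real_inner_comm, ξφ]
  have φu : ∀ u, (inner ℝ u (φ u) : ℝ) = 0 := fun u ↦ by
    have := φskew u u
    rw [real_inner_comm] at this; linarith
  -- The deviation from the model satisfies the homogeneous identities of a Kähler curvature tensor:
  -- the inhomogeneous terms of `Rφ` and `Rξ` are the same for the model and cancel.
  set B : V → V → V → V → ℝ := fun u v w z ↦ inner ℝ (R u v w) z - spaceFormTensor φ ξ c u v w z
    with hB
  have φφi : ∀ u v, (inner ℝ (φ u) (φ v) : ℝ) = inner ℝ u v - inner ℝ u ξ * inner ℝ v ξ := by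
    intro u v
    rw [φskew, φφ]
    simp only [inner_add_right, inner_neg_right, inner_smul_right]
    ring
  have cm : ∀ u v : V, (inner ℝ u v : ℝ) = inner ℝ v u := fun u v ↦ real_inner_comm v u
  have A : ∀ u v : V, (inner ℝ u (φ v) : ℝ) = - inner ℝ v (φ u) := fun u v ↦ by
    rw [cm, φskew]
  have Banti : ∀ u v w z, B u v w z = - B v u w z := by
    intro u v w z
    simp only [hB, spaceFormTensor]
    rw [anti u v, inner_neg_left, cm u (φ v), φskew v u]
    ring
  have Bskew : ∀ u v w z, B u v w z = - B u v z w := by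
    intro u v w z
    simp only [hB, spaceFormTensor]
    rw [skew u v w z, cm w (R u v z)]
    simp only [φskew]
    rw [A w v, A w u, A z v, A z u, A z w, cm w v, cm w u, cm z v, cm z u]
    ring
  have Bbianchi : ∀ u v w z, B u v w z + B v w u z + B w u v z = 0 := by
    intro u v w z
    have := congrArg (fun y ↦ (inner ℝ y z : ℝ)) (bianchi u v w)
    simp only [inner_add_left, inner_zero_left] at this
    simp only [hB, spaceFormTensor]
    rw [cm v w, cm u w, cm v u, cm w (φ v), φskew v w, cm w (φ u), φskew u w, cm v (φ u), φskew u v]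
    linear_combination this
  have Badd : ∀ u v w z z', B u v w (z + z') = B u v w z + B u v w z' := by
    intro u v w z z'
    simp only [hB, spaceFormTensor, inner_add_left, inner_add_right]
    ring
  have BJ : ∀ u v w z, B u v (φ w) z = - B u v w (φ z) := by
    intro u v w z
    simp only [hB, spaceFormTensor]
    rw [Rφ]
    simp only [inner_add_left, inner_sub_left, inner_smul_left, φφ, inner_neg_left, φskew,
      inner_add_right, inner_neg_right, inner_smul_right, RCLike.conj_to_real]
    rw [cm w (φ u), cm w (φ v)]
    simp only [φskew, cm ξ, φξ, inner_zero_right]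
    rw [cm w v, cm w u]
    ring
  -- Vanishing on `ξ` is what lets `φ²` act as `-1` in a slot of `B`, although `φ² ≠ -1` on the
  -- whole space.
  have Bξ : ∀ u v w, B u v w ξ = 0 := by
    intro u v w
    rw [Bskew]
    simp only [hB, spaceFormTensor, Rξ, φξ]
    simp only [inner_sub_left, inner_smul_left, ξξ, ξφ', RCLike.conj_to_real, inner_zero_left, cm ξ]
    ring
  have BJJ : ∀ u v w z, B u v w (φ (φ z)) = - B u v w z := by
    intro u v w z
    have e : B u v w (-z + (inner ℝ z ξ : ℝ) • ξ) = - B u v w z + inner ℝ z ξ * B u v w ξ := by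
      simp only [hB, spaceFormTensor, inner_add_left, inner_add_right, inner_neg_left,
        inner_neg_right, inner_smul_left, inner_smul_right, RCLike.conj_to_real]
      ring
    rw [φφ, e, Bξ, mul_zero, add_zero]
  have Bsmul : ∀ u v w z (a : ℝ), B u v w (a • z) = a * B u v w z := by
    intro u v w z a
    simp only [hB, spaceFormTensor, inner_smul_left, inner_smul_right, RCLike.conj_to_real]
    ring
  have pair := curvature_pair_symm B Banti Bskew Bbianchi
  have Bsmul' : ∀ u (a : ℝ), B (a • u) (φ (a • u)) (φ (a • u)) (a • u)
      = a ^ 4 * B u (φ u) (φ u) u := by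
    intro u a
    have s3 : ∀ u v w z (a : ℝ), B u v (a • w) z = a * B u v w z := fun u v w z a ↦ by
      rw [Bskew, Bsmul, Bskew u v w]; ring
    have s1 : ∀ u v w z (a : ℝ), B (a • u) v w z = a * B u v w z := fun u v w z a ↦ by
      rw [pair, s3, pair u]
    have s2 : ∀ u v w z (a : ℝ), B u (a • v) w z = a * B u v w z := fun u v w z a ↦ by
      rw [pair, Bsmul, pair u]
    simp only [map_smul, s1, s2, s3, Bsmul]
    ring
  have hol_unit : ∀ u, (inner ℝ u ξ : ℝ) = 0 → (inner ℝ u u : ℝ) = 1 → B u (φ u) (φ u) u = 0 := by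
    intro u h h'
    simp only [hB, spaceFormTensor]
    rw [sec u h h', φφi, φskew, φφ, φu]
    simp only [inner_add_right, inner_neg_right, inner_zero_right, h, h', ξφ,
      cm (φ u) u, φu, inner_add_left, inner_neg_left, zero_smul, inner_zero_left]
    ring
  have hol_perp : ∀ u, (inner ℝ u ξ : ℝ) = 0 → B u (φ u) (φ u) u = 0 := by
    intro u h
    rcases eq_or_ne u 0 with rfl | hu
    · simpa using Bsmul 0 (φ 0) (φ 0) 0 0
    have hn : ‖u‖ ≠ 0 := norm_ne_zero_iff.2 hu
    have := hol_unit (‖u‖⁻¹ • u) (by rw [inner_smul_left, h, mul_zero]) (by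
      rw [inner_smul_left, inner_smul_right, real_inner_self_eq_norm_sq]
      simp only [RCLike.conj_to_real]
      field_simp)
    rw [Bsmul'] at this
    exact (mul_eq_zero.1 this).resolve_left (by positivity)
  -- For arbitrary `u` apply the orthogonal case to `φ u`, which is orthogonal to `ξ`, and remove
  -- the extra `φ`s by the symmetries.
  have hol : ∀ u, B u (φ u) (φ u) u = 0 := by
    intro u
    have h := hol_perp (φ u) (ξφ u)
    have JJ : ∀ u v w z, B u v (φ w) (φ z) = B u v w z := fun u v w z ↦ by rw [BJ, BJJ, neg_neg]
    rwa [pair, JJ, pair, BJ, BJJ, neg_neg] at h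
  have := kaehler_curvature_eq_zero B φ (fun u v ↦ map_add φ u v) Badd Banti Bskew Bbianchi BJ BJJ
    hol u v w z
  exact sub_eq_zero.1 this

end algebra

/-! ### The curvature tensor at a point, and the curvature of Sasakian manifolds. -/

section pointwise

open FiberBundle VectorField Filter Topology

variable {E : Type*} [NormedAddCommGroup E] [NormedSpace ℝ E] [FiniteDimensional ℝ E]
  [CompleteSpace E]
  {H : Type*} [TopologicalSpace H] {I : ModelWithCorners ℝ E H}
  {M : Type*} [TopologicalSpace M] [ChartedSpace H M] [IsManifold I ∞ M]
  {conn : CovariantDerivative I E (TangentSpace I : M → Type _)}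

lemma conn_congr {X X' : Π x : M, TangentSpace I x} {x : M} (hX' : CMDiff ∞ (T% X'))
    (h : X =ᶠ[𝓝 x] X') : conn X x = conn X' x := by
  have h1 : MDiffAt (T% X') x := mdiffAt_of_smooth hX'
  refine conn.isCovariantDerivativeOn.congr_of_eventuallyEq (s := univ) ?_ h1 univ_mem h
  exact h1.congr_of_eventuallyEq (h.mono fun y hy ↦ by simp [hy])

lemma exists_smooth_extension [T2Space M]
    (hconn : CovariantDerivative.ContMDiffCovariantDerivative conn ∞) (x : M) :
    ∃ ext : TangentSpace I x → Π y : M, TangentSpace I y,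
      (∀ v, CMDiff ∞ (T% (ext v))) ∧ (∀ v, ext v x = v) ∧
      ∀ u v w, curvature conn x u v w = curvatureField conn (ext u) (ext v) (ext w) x := by
  obtain ⟨s, hs, hso, h⟩ := exists_smooth_extend (I := I) x
  choose ext h1 h2 h3 using h
  refine ⟨ext, h1, h2, fun u v w ↦ ?_⟩
  have e : ∀ v : TangentSpace I x, ∀ y ∈ s,
      (extend E v : Π y : M, TangentSpace I y) =ᶠ[𝓝 y] ext v := fun v y hy ↦
    eventually_of_mem (hso.mem_nhds hy) fun z hz ↦ (h3 v z hz).symm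
  have hx : x ∈ s := mem_of_mem_nhds hs
  have key : ∀ u v w, conn (fun y ↦ conn (extend E w) y (extend E v y)) x u
      = conn (fun y ↦ conn (ext w) y (ext v y)) x u := by
    intro u v w
    rw [conn_congr (smooth_conn hconn (h1 v) (h1 w))]
    filter_upwards [hs] with y hy
    rw [h3 v y hy, conn_congr (h1 w) (e w y hy)]
  rw [curvature, curvatureField, curvatureField, key, key, conn_congr (h1 w) (e w x hx),
    (e u x hx).mlieBracket_vectorField_eq (e v x hx)]
  simp only [extend_apply_self, h2]

section metric

variable [T2Space M] [RiemannianBundle (fun x : M ↦ TangentSpace I x)]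
    [IsContMDiffRiemannianBundle I ∞ E (fun x : M ↦ TangentSpace I x)]
    (hc : IsLeviCivita conn)

include hc

/-- The curvature is a tensor. -/
lemma IsLeviCivita.exists_extension (x : M) :
    ∃ ext : TangentSpace I x → Π y : M, TangentSpace I y,
      (∀ v, CMDiff ∞ (T% (ext v))) ∧ (∀ v, ext v x = v) ∧
      ∀ u v, ∀ Z : Π y : M, TangentSpace I y, CMDiff ∞ (T% Z) →
        curvature conn x u v (Z x) = curvatureField conn (ext u) (ext v) Z x := by
  obtain ⟨ext, h1, h2, h3⟩ := exists_smooth_extension hc.smooth x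
  refine ⟨ext, h1, h2, fun u v Z hZ ↦ ?_⟩
  refine ext_inner_right ℝ fun w ↦ ?_
  -- Skew-symmetry moves the curvature operator onto the fixed extension of `w`, leaving an
  -- expression that sees `Z` only through `Z x`.
  have e1 := hc.inner_curvatureField (h1 u) (h1 v) hZ (h1 w) (x := x)
  have e2 := hc.inner_curvatureField (h1 u) (h1 v) (h1 (Z x)) (h1 w) (x := x)
  rw [h2] at e1 e2
  rw [h2] at e2
  rw [h3, e1, e2]

lemma IsLeviCivita.curvature_swap (x : M) (u v w : TangentSpace I x) :
    curvature conn x u v w = - curvature conn x v u w := by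
  obtain ⟨ext, h1, h2, h3⟩ := exists_smooth_extension hc.smooth x
  rw [h3, h3, curvatureField_swap]

lemma IsLeviCivita.inner_curvature (x : M) (u v w z : TangentSpace I x) :
    (inner ℝ (curvature conn x u v w) z : ℝ) = - inner ℝ w (curvature conn x u v z) := by
  obtain ⟨ext, h1, h2, h3⟩ := exists_smooth_extension hc.smooth x
  have := hc.inner_curvatureField (h1 u) (h1 v) (h1 w) (h1 z) (x := x)
  rw [h2, h2] at this
  rw [h3, h3, this]

lemma IsLeviCivita.bianchi_curvature (x : M) (u v w : TangentSpace I x) :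
    curvature conn x u v w + curvature conn x v w u + curvature conn x w u v = 0 := by
  obtain ⟨ext, h1, h2, h3⟩ := exists_smooth_extension hc.smooth x
  rw [h3, h3, h3, hc.bianchi_curvatureField (h1 u) (h1 v) (h1 w)]

end metric

section sasakian

variable [RiemannianBundle (fun x : M ↦ TangentSpace I x)]
  {φ : Π x : M, TangentSpace I x →L[ℝ] TangentSpace I x} {ξ : Π x : M, TangentSpace I x}
  {η : Π x : M, TangentSpace I x →L[ℝ] ℝ}

/-- Since `φ²ξ = 0`, evaluating `φ²` on `φξ` shows `φξ = a ξ`; applying `φ` again gives `a² = 0`. -/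
lemma IsContactMetric.φ_ξ (h : IsContactMetric φ ξ η) (x : M) : φ x (ξ x) = 0 := by
  have h1 : φ x (φ x (ξ x)) = 0 := by simp [h.φ_sq, h.η_ξ]
  have h2 := h.φ_sq x (φ x (ξ x))
  rw [h1, map_zero] at h2
  obtain ⟨a, h3⟩ : ∃ a : ℝ, φ x (ξ x) = a • ξ x := ⟨_, neg_add_eq_zero.1 h2.symm⟩
  rw [h3, map_smul, h3, smul_smul] at h1
  have h4 := congrArg (η x) h1
  rw [map_smul, h.η_ξ, map_zero, smul_eq_mul, mul_one] at h4
  rw [h3, mul_self_eq_zero.1 h4, zero_smul]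

lemma IsContactMetric.η_eq (h : IsContactMetric φ ξ η) (x : M) (u : TangentSpace I x) :
    η x u = inner ℝ u (ξ x) := by
  have := h.inner_φ x u (ξ x)
  rw [h.φ_ξ, inner_zero_right, h.η_ξ] at this
  linarith

lemma IsContactMetric.inner_ξ_ξ (h : IsContactMetric φ ξ η) (x : M) :
    (inner ℝ (ξ x) (ξ x) : ℝ) = 1 := by
  rw [← h.η_eq, h.η_ξ]

lemma IsContactMetric.inner_φ_left (h : IsContactMetric φ ξ η) (x : M) (u v : TangentSpace I x) :
    (inner ℝ (φ x u) v : ℝ) = - inner ℝ u (φ x v) := by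
  have h1 := h.inner_φ x u (φ x v)
  rw [h.φ_sq, inner_add_right, inner_neg_right, inner_smul_right, ← h.η_eq] at h1
  -- Compute `φ³u` in two ways, as `φ²(φu)` and as `φ(φ²u)`.
  have h2 : ∀ u, η x (φ x u) = 0 := by
    intro u
    have e1 := h.φ_sq x (φ x u)
    have e2 := congrArg (φ x) (h.φ_sq x u)
    rw [map_add, map_smul, h.φ_ξ, smul_zero, add_zero, map_neg] at e2
    rw [e2] at e1
    have e3 : η x (φ x u) • ξ x = 0 := by simpa using e1
    have e4 := congrArg (η x) e3
    simpa [h.η_ξ] using e4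
  rw [h2, h2] at h1
  linarith

lemma IsContactMetric.smooth_φ_apply (h : IsContactMetric φ ξ η) {X : Π x : M, TangentSpace I x}
    (hX : CMDiff ∞ (T% X)) : CMDiff ∞ (T% (fun y ↦ φ y (X y))) :=
  h.smooth_φ.clm_bundle_apply hX

variable [IsContMDiffRiemannianBundle I ∞ E (fun x : M ↦ TangentSpace I x)]

/-- The Sasakian identity on `Y = ξ` gives `φ(∇_u ξ)`. Applying `φ` recovers `∇_u ξ` up to its
`ξ`-component, which vanishes because `ξ` has unit length. -/
lemma IsSasakian.conn_ξ (h : IsSasakian conn φ ξ η) (hc : IsLeviCivita conn) (x : M)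
    (u : TangentSpace I x) : conn ξ x u = - φ x u := by
  have hξ : MDiffAt (T% ξ) x := mdiffAt_of_smooth h.smooth_ξ
  have h1 := h.nabla_φ x u ξ hξ
  have h0 : (fun y ↦ φ y (ξ y)) = 0 := by ext y; exact h.φ_ξ y
  rw [h0, CovariantDerivative.zero, ← h.η_eq, h.η_ξ] at h1
  have h2 := hc.metric x u ξ ξ hξ hξ
  have h3 : (fun y ↦ (inner ℝ (ξ y) (ξ y) : ℝ)) = fun _ ↦ 1 := by ext y; exact h.inner_ξ_ξ y
  rw [h3, mvfderiv_const, real_inner_comm (conn ξ x u)] at h2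
  have h4 : η x (conn ξ x u) = 0 := by
    rw [h.η_eq]
    simp only [zero_apply] at h2
    linarith
  have h5 := congrArg (φ x) h1
  simp only [Pi.zero_apply, zero_apply, zero_sub, map_neg, h.φ_sq, h4, map_sub,
    map_smul, h.φ_ξ] at h5
  simpa using h5

variable [T2Space M]

lemma IsSasakian.curvature_ξ (h : IsSasakian conn φ ξ η) (hc : IsLeviCivita conn) (x : M)
    (u v : TangentSpace I x) : curvature conn x u v (ξ x)
      = (inner ℝ v (ξ x) : ℝ) • u - (inner ℝ u (ξ x) : ℝ) • v := by
  obtain ⟨ext, h1, h2, h3⟩ := hc.exists_extension x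
  rw [h3 _ _ ξ h.smooth_ξ, curvatureField]
  have e : ∀ u v, conn (fun y ↦ conn ξ y (ext v y)) x u
      = - (φ x (conn (ext v) x u) + (inner ℝ u v : ℝ) • ξ x - η x v • u) := by
    intro u v
    have : (fun y ↦ conn ξ y (ext v y)) = fun y ↦ (-1 : ℝ) • φ y (ext v y) := by
      ext y; rw [h.conn_ξ hc, neg_one_smul]
    rw [this, conn_fun_const_smul _ (h.smooth_φ_apply (h1 v))]
    have := h.nabla_φ x u _ (mdiffAt_of_smooth (h1 v))
    rw [h2] at this
    rw [smul_apply, neg_one_smul, sub_eq_iff_eq_add.1 this]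
    abel
  rw [e, e, h.conn_ξ hc, hc.mlieBracket (h1 u) (h1 v), map_sub, h2, h2, h.η_eq, h.η_eq,
    real_inner_comm u v]
  module

/-- The commutator of `R(u,v)` with `φ` comes from differentiating the Sasakian identity a second
time and antisymmetrizing; `∇ξ = -φ` produces the terms without curvature. -/
lemma IsSasakian.curvature_φ (h : IsSasakian conn φ ξ η) (hc : IsLeviCivita conn) (x : M)
    (u v w : TangentSpace I x) : curvature conn x u v (φ x w)
      = φ x (curvature conn x u v w) - (inner ℝ v w : ℝ) • φ x u + (inner ℝ u w : ℝ) • φ x v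
      + (inner ℝ w (φ x u) : ℝ) • v - (inner ℝ w (φ x v) : ℝ) • u := by
  obtain ⟨ext, h1, h2, h3⟩ := hc.exists_extension x
  have hw := h3 u v (ext w) (h1 w)
  have hφw := h3 u v _ (h.smooth_φ_apply (h1 w))
  rw [h2] at hw
  simp only [h2] at hφw
  rw [hφw, hw, curvatureField, curvatureField]
  have e0 : ∀ y (a : TangentSpace I y), conn (fun y ↦ φ y (ext w y)) y a
      = φ y (conn (ext w) y a)
        + ((inner ℝ a (ext w y) : ℝ) • ξ y - (inner ℝ (ext w y) (ξ y) : ℝ) • a) := by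
    intro y a
    rw [← h.η_eq, ← h.nabla_φ y a _ (mdiffAt_of_smooth (h1 w))]
    abel
  have e : ∀ u v, conn (fun y ↦ conn (fun y ↦ φ y (ext w y)) y (ext v y)) x u
      = φ x (conn (fun y ↦ conn (ext w) y (ext v y)) x u)
        + (inner ℝ u (conn (ext w) x v) : ℝ) • ξ x - (inner ℝ (conn (ext w) x v) (ξ x) : ℝ) • u
        + (inner ℝ (conn (ext v) x u) w + inner ℝ v (conn (ext w) x u) : ℝ) • ξ x
        - (inner ℝ v w : ℝ) • φ x u
        - (inner ℝ (conn (ext w) x u) (ξ x) - inner ℝ w (φ x u) : ℝ) • v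
        - (inner ℝ w (ξ x) : ℝ) • conn (ext v) x u := by
    intro u v
    have : (fun y ↦ conn (fun y ↦ φ y (ext w y)) y (ext v y)) = fun y ↦
        φ y (conn (ext w) y (ext v y)) + ((inner ℝ (ext v y) (ext w y) : ℝ) • ξ y
          - (inner ℝ (ext w y) (ξ y) : ℝ) • ext v y) := by
      ext y; rw [e0]
    have s1 := smooth_conn hc.smooth (h1 v) (h1 w)
    have s2 := smooth_inner (h1 v) (h1 w)
    have s3 := smooth_inner (h1 w) h.smooth_ξ
    have n := h.nabla_φ x u _ (mdiffAt_of_smooth s1)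
    rw [sub_eq_iff_eq_add] at n
    rw [this, conn_fun_add (h.smooth_φ_apply s1)
      (smooth_fun_sub (smooth_fun_smul s2 h.smooth_ξ) (smooth_fun_smul s3 (h1 v))),
      conn_fun_sub (smooth_fun_smul s2 h.smooth_ξ) (smooth_fun_smul s3 (h1 v)),
      conn_fun_smul s2 h.smooth_ξ, conn_fun_smul s3 (h1 v)]
    simp only [add_apply, sub_apply, smul_apply, ContinuousLinearMap.smulRight_apply]
    rw [n, hc.metric x u _ _ (mdiffAt_of_smooth (h1 v)) (mdiffAt_of_smooth (h1 w)),
      hc.metric x u _ _ (mdiffAt_of_smooth (h1 w)) (mdiffAt_of_smooth h.smooth_ξ),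
      h.conn_ξ hc, h.η_eq]
    simp only [h2, inner_neg_right]
    module
  rw [e, e, e0, hc.mlieBracket (h1 u) (h1 v)]
  simp only [h2, inner_sub_left, map_sub]
  module

/-- The curvature tensor of a Sasakian space form. -/
theorem IsSasakianSpaceForm.inner_curvature {c : ℝ} (h : IsSasakianSpaceForm conn φ ξ η c)
    (hc : IsLeviCivita conn) (x : M) (u v w z : TangentSpace I x) :
    inner ℝ (curvature conn x u v w) z = spaceFormTensor (φ x) (ξ x) c u v w z := by
  refine inner_eq_spaceFormTensor (φ x) (ξ x) c (curvature conn x) ?_ (h.φ_ξ x) (h.inner_ξ_ξ x)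
    (h.inner_φ_left x) (hc.curvature_swap x) (hc.inner_curvature x) (hc.bianchi_curvature x)
    (h.curvature_ξ hc x) (h.curvature_φ hc x) ?_ u v w z
  · intro u
    rw [h.φ_sq, h.η_eq]
  · intro u hu hu'
    have := h.sectional x u hu' hu
    rw [sectionalCurvature, h.inner_φ, h.η_eq, hu, hu'] at this
    have e : (inner ℝ u (φ x u) : ℝ) = 0 := by
      have := h.inner_φ_left x u u
      rw [real_inner_comm] at this; linarith
    rw [e] at this
    simpa using this

end sasakian

end pointwise

/-! ### Covariant differentiation of vector fields along a curve. -/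

section along

open FiberBundle VectorField Filter Topology

variable {E : Type*} [NormedAddCommGroup E] [NormedSpace ℝ E] [FiniteDimensional ℝ E]
  [CompleteSpace E]
  {H : Type*} [TopologicalSpace H] {I : ModelWithCorners ℝ E H}
  {M : Type*} [TopologicalSpace M] [ChartedSpace H M] [IsManifold I ∞ M]
  {conn : CovariantDerivative I E (TangentSpace I : M → Type _)}

variable (I) in
/-- A vector field along a curve, smooth at a parameter. -/
def SmoothAlongAt (γ : ℝ → M) (V : Π t : ℝ, TangentSpace I (γ t)) (t : ℝ) : Prop :=
  ContMDiffAt 𝓘(ℝ, ℝ) (I.prod 𝓘(ℝ, E)) ∞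
    (fun s ↦ TotalSpace.mk' E (E := fun x : M ↦ TangentSpace I x) (γ s) (V s)) t

variable {γ : ℝ → M} {V W : Π t : ℝ, TangentSpace I (γ t)} {t : ℝ}

lemma smoothAlongAt_iff : SmoothAlongAt I γ V t ↔ ContMDiffAt 𝓘(ℝ, ℝ) I ∞ γ t ∧
    ContDiffAt ℝ ∞ (fun s ↦ (trivializationAt E (TangentSpace I : M → Type _) (γ t)
        (TotalSpace.mk' E (γ s) (V s))).2) t := by
  rw [SmoothAlongAt, contMDiffAt_totalSpace, contMDiffAt_iff_contDiffAt]

lemma SmoothAlongAt.eventually_mem (hV : SmoothAlongAt I γ V t) :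
    ∀ᶠ s in 𝓝 t, γ s ∈ (trivializationAt E (TangentSpace I : M → Type _) (γ t)).baseSet :=
  (smoothAlongAt_iff.1 hV).1.continuousAt.preimage_mem_nhds
    ((trivializationAt E (TangentSpace I : M → Type _) (γ t)).open_baseSet.mem_nhds
      (mem_baseSet_trivializationAt' (γ t)))

lemma SmoothAlongAt.congr (hV : SmoothAlongAt I γ V t) (h : ∀ᶠ s in 𝓝 t, W s = V s) :
    SmoothAlongAt I γ W t :=
  ContMDiffAt.congr_of_eventuallyEq hV (h.mono fun s hs ↦ by simp [hs])

lemma SmoothAlongAt.add (hV : SmoothAlongAt I γ V t) (hW : SmoothAlongAt I γ W t) :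
    SmoothAlongAt I γ (fun s ↦ V s + W s) t := by
  rw [smoothAlongAt_iff]
  refine ⟨(smoothAlongAt_iff.1 hV).1, ((smoothAlongAt_iff.1 hV).2.add
    (smoothAlongAt_iff.1 hW).2).congr_of_eventuallyEq ?_⟩
  filter_upwards [hV.eventually_mem] with s hs
  exact (Trivialization.linear ℝ _ hs).map_add (V s) (W s)

lemma SmoothAlongAt.smul {f : ℝ → ℝ} (hf : ContDiffAt ℝ ∞ f t) (hV : SmoothAlongAt I γ V t) :
    SmoothAlongAt I γ (fun s ↦ f s • V s) t := by
  rw [smoothAlongAt_iff]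
  refine ⟨(smoothAlongAt_iff.1 hV).1, (hf.smul (smoothAlongAt_iff.1 hV).2).congr_of_eventuallyEq ?_⟩
  filter_upwards [hV.eventually_mem] with s hs
  exact (Trivialization.linear ℝ _ hs).map_smul (f s) (V s)

lemma SmoothAlongAt.zero (hγ : ContMDiffAt 𝓘(ℝ, ℝ) I ∞ γ t) :
    SmoothAlongAt I γ (fun _ ↦ 0) t :=
  (contMDiff_zeroSection ℝ (TangentSpace I : M → Type _)).contMDiffAt.comp t hγ

lemma SmoothAlongAt.comp (hγ : ContMDiffAt 𝓘(ℝ, ℝ) I ∞ γ t) {X : Π x : M, TangentSpace I x}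
    (hX : CMDiff ∞ (T% X)) : SmoothAlongAt I γ (fun s ↦ X (γ s)) t :=
  hX.contMDiffAt.comp t hγ

lemma hasDerivAt_comp_curve (hγ : ContMDiffAt 𝓘(ℝ, ℝ) I ∞ γ t) {g : M → ℝ} (hg : CMDiff ∞ g) :
    HasDerivAt (fun s ↦ g (γ s)) (mvfderiv I g (γ t) (velocity I γ t)) t := by
  have h1 := hγ.mdifferentiableAt (by simp)
  have h2 : MDiffAt g (γ t) := hg.mdifferentiable (by simp) (γ t)
  have h3 := h2.hasMFDerivAt.comp t h1.hasMFDerivAt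
  have h4 : HasFDerivAt (𝕜 := ℝ) (E := ℝ) (F := ℝ) (fun s ↦ g (γ s)) _ t :=
    hasMFDerivAt_iff_hasFDerivAt.1 h3
  exact h4.hasDerivAt

/-- A field along a curve and its covariant derivative in a local frame. -/
lemma SmoothAlongAt.exists_expansion [T2Space M] (hV : SmoothAlongAt I γ V t) :
    ∃ (n : ℕ) (X : Fin n → Π x : M, TangentSpace I x) (c : Fin n → ℝ → ℝ),
      (∀ i, CMDiff ∞ (T% (X i))) ∧ (∀ i, ContDiffAt ℝ ∞ (c i) t) ∧
      (∀ᶠ s in 𝓝 t, V s = ∑ i, c i s • X i (γ s)) ∧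
      covDerivAlong conn γ V t = ∑ i, (deriv (c i) t • X i (γ t)
        + c i t • conn (X i) (γ t) (velocity I γ t)) := by
  set e := trivializationAt E (TangentSpace I : M → Type _) (γ t) with he
  have hmem : γ t ∈ e.baseSet := mem_baseSet_trivializationAt' (γ t)
  let b := Module.finBasis ℝ E
  obtain ⟨u, hu, huo, h⟩ := exists_smooth_extend (I := I) (γ t)
  choose ext h1 h2 h3 using h
  let X : Fin (Module.finrank ℝ E) → Π x : M, TangentSpace I x := fun i ↦ ext (e.symm (γ t) (b i))
  let v : ℝ → E := fun s ↦ (e (TotalSpace.mk' E (γ s) (V s))).2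
  have hv : ContDiffAt ℝ ∞ v t := (smoothAlongAt_iff.1 hV).2
  let c : Fin (Module.finrank ℝ E) → ℝ → ℝ := fun i s ↦ b.coord i (v s)
  have hcs : ∀ i, ContDiffAt ℝ ∞ (c i) t := fun i ↦
    (LinearMap.toContinuousLinearMap (b.coord i)).contDiff.contDiffAt.comp t hv
  have hcd : ∀ i, deriv (c i) t = b.coord i (deriv v t) := fun i ↦
    ((LinearMap.toContinuousLinearMap (b.coord i)).hasFDerivAt.comp_hasDerivAt t
      (hv.differentiableAt (by simp)).hasDerivAt).deriv
  have hX : ∀ i, ∀ y ∈ u ∩ e.baseSet, X i y = e.symm y (b i) := by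
    intro i y hy
    simp only [X]
    rw [h3 _ y hy.1, extend, ← he, Trivialization.apply_mk_symm _ hmem]
  have hsum : ∀ y ∈ u ∩ e.baseSet, ∀ w : E, ∑ i, b.coord i w • X i y = e.symm y w := by
    intro y hy w
    have : e.symm y w = e.symmL ℝ y w :=
      (Trivialization.symmL_apply (R := ℝ) e hy.2 w).symm
    rw [this]
    conv_rhs => rw [← b.sum_repr w, map_sum]
    refine Finset.sum_congr rfl fun i _ ↦ ?_
    rw [hX i y hy, map_smul, Trivialization.symmL_apply (R := ℝ) e hy.2]
    rfl
  have hnear : ∀ᶠ s in 𝓝 t, γ s ∈ u ∩ e.baseSet :=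
    (smoothAlongAt_iff.1 hV).1.continuousAt.preimage_mem_nhds
      (inter_mem hu (e.open_baseSet.mem_nhds hmem))
  refine ⟨_, X, c, fun i ↦ h1 _, hcs, ?_, ?_⟩
  · filter_upwards [hnear] with s hs
    rw [hsum _ hs, Trivialization.symm_apply_apply_mk _ hs.2]
  · rw [Finset.sum_add_distrib, covDerivAlong, ← he]
    congr 1
    · simp only [hcd]
      rw [hsum _ ⟨mem_of_mem_nhds hu, hmem⟩]
    · have e1 : conn (extend E (V t)) (γ t) = conn (fun y ↦ ∑ i, c i t • X i y) (γ t) := by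
        refine conn_congr ?_ ?_
        · exact ContMDiff.sum_section fun i _ ↦ smooth_fun_const_smul _ (h1 _)
        · filter_upwards [inter_mem hu (e.open_baseSet.mem_nhds hmem)] with y hy
          rw [hsum _ hy]; rfl
      have e2 : ∀ s : Finset (Fin (Module.finrank ℝ E)),
          conn (fun y ↦ ∑ i ∈ s, c i t • X i y) (γ t) = ∑ i ∈ s, c i t • conn (X i) (γ t) := by
        intro s
        induction s using Finset.induction_on with
        | empty => exact congrFun conn.zero (γ t)
        | insert i s hi ih =>
          simp only [Finset.sum_insert hi]
          rw [conn_fun_add (smooth_fun_const_smul _ (h1 _))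
            (ContMDiff.sum_section fun i _ ↦ smooth_fun_const_smul _ (h1 _)), ih,
            conn_fun_const_smul _ (h1 _)]
      rw [e1, e2]
      simp

section metric

variable [T2Space M] [RiemannianBundle (fun x : M ↦ TangentSpace I x)]
    [IsContMDiffRiemannianBundle I ∞ E (fun x : M ↦ TangentSpace I x)]
    (hc : IsLeviCivita conn)

lemma SmoothAlongAt.contDiffAt_inner (hV : SmoothAlongAt I γ V t) (hW : SmoothAlongAt I γ W t) :
    ContDiffAt ℝ ∞ (fun s ↦ (inner ℝ (V s) (W s) : ℝ)) t :=
  contMDiffAt_iff_contDiffAt.1 (ContMDiffAt.inner_bundle (IB := I) (n := ∞) (F := E) (B := M)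
    (E := fun x : M ↦ TangentSpace I x) (M := ℝ) (EM := ℝ) (HM := ℝ) (IM := 𝓘(ℝ, ℝ)) (b := γ)
    (x := t) (v := V) (w := W) hV hW)

include hc

lemma IsLeviCivita.hasDerivAt_inner_field (hV : SmoothAlongAt I γ V t)
    {Z : Π x : M, TangentSpace I x} (hZ : CMDiff ∞ (T% Z)) :
    HasDerivAt (fun s ↦ (inner ℝ (V s) (Z (γ s)) : ℝ))
      (inner ℝ (covDerivAlong conn γ V t) (Z (γ t))
        + inner ℝ (V t) (conn Z (γ t) (velocity I γ t))) t := by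
  have hγ := (smoothAlongAt_iff.1 hV).1
  obtain ⟨n, X, c, hX, hcs, hVX, hD⟩ := hV.exists_expansion (conn := conn)
  have h1 : ∀ i, HasDerivAt (fun s ↦ c i s * (inner ℝ (X i (γ s)) (Z (γ s)) : ℝ))
      (deriv (c i) t * inner ℝ (X i (γ t)) (Z (γ t)) + c i t *
        (inner ℝ (conn (X i) (γ t) (velocity I γ t)) (Z (γ t))
          + inner ℝ (X i (γ t)) (conn Z (γ t) (velocity I γ t)))) t := by
    intro i
    have := hasDerivAt_comp_curve hγ (smooth_inner (hX i) hZ)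
    rw [hc.metric _ _ _ _ (mdiffAt_of_smooth (hX i)) (mdiffAt_of_smooth hZ)] at this
    exact ((hcs i).differentiableAt (by simp)).hasDerivAt.mul this
  have h2 := HasDerivAt.fun_sum (u := Finset.univ) fun i _ ↦ h1 i
  have h3 : (fun s ↦ (inner ℝ (V s) (Z (γ s)) : ℝ)) =ᶠ[𝓝 t]
      fun s ↦ ∑ i, c i s * (inner ℝ (X i (γ s)) (Z (γ s)) : ℝ) := by
    filter_upwards [hVX] with s hs
    rw [hs, sum_inner]
    simp only [inner_smul_left, RCLike.conj_to_real]
  refine (h2.congr_of_eventuallyEq h3).congr_deriv ?_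
  rw [hD, hVX.self_of_nhds, sum_inner, sum_inner, ← Finset.sum_add_distrib]
  refine Finset.sum_congr rfl fun i _ ↦ ?_
  simp only [inner_smul_left, RCLike.conj_to_real, inner_add_left]
  ring

lemma IsLeviCivita.hasDerivAt_inner_along (hV : SmoothAlongAt I γ V t)
    (hW : SmoothAlongAt I γ W t) :
    HasDerivAt (fun s ↦ (inner ℝ (V s) (W s) : ℝ))
      (inner ℝ (covDerivAlong conn γ V t) (W t) + inner ℝ (V t) (covDerivAlong conn γ W t)) t := by
  obtain ⟨n, X, c, hX, hcs, hWX, hD⟩ := hW.exists_expansion (conn := conn)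
  have h2 := HasDerivAt.fun_sum (u := Finset.univ) fun i _ ↦
    ((hcs i).differentiableAt (by simp)).hasDerivAt.mul (hc.hasDerivAt_inner_field hV (hX i))
  have h3 : (fun s ↦ (inner ℝ (V s) (W s) : ℝ)) =ᶠ[𝓝 t]
      fun s ↦ ∑ i, (c i * fun s ↦ (inner ℝ (V s) (X i (γ s)) : ℝ)) s := by
    filter_upwards [hWX] with s hs
    rw [hs, inner_sum]
    simp only [inner_smul_right, Pi.mul_apply]
  refine (h2.congr_of_eventuallyEq h3).congr_deriv ?_
  rw [hD, hWX.self_of_nhds, inner_sum, inner_sum, ← Finset.sum_add_distrib]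
  refine Finset.sum_congr rfl fun i _ ↦ ?_
  simp only [inner_smul_right, inner_add_right]
  ring

/-- Restrictions of smooth fields on `M` take every value at `γ t`, so the product rule against them
determines the covariant derivative. The calculus rules below then follow from ordinary derivatives
of inner products. -/
lemma IsLeviCivita.covDerivAlong_eq_of_inner (hV : SmoothAlongAt I γ V t)
    (D : TangentSpace I (γ t))
    (h : ∀ Z : Π x : M, TangentSpace I x, CMDiff ∞ (T% Z) →
      HasDerivAt (fun s ↦ (inner ℝ (V s) (Z (γ s)) : ℝ))
        (inner ℝ D (Z (γ t)) + inner ℝ (V t) (conn Z (γ t) (velocity I γ t))) t) :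
    covDerivAlong conn γ V t = D := by
  refine ext_inner_right ℝ fun z ↦ ?_
  obtain ⟨u, -, -, hu⟩ := exists_smooth_extend (I := I) (γ t)
  obtain ⟨Z, hZ, rfl, -⟩ := hu z
  exact add_right_cancel ((hc.hasDerivAt_inner_field hV hZ).unique (h Z hZ))

lemma IsLeviCivita.covDerivAlong_congr (hW : SmoothAlongAt I γ W t)
    (h : ∀ᶠ s in 𝓝 t, V s = W s) : covDerivAlong conn γ V t = covDerivAlong conn γ W t := by
  refine hc.covDerivAlong_eq_of_inner (hW.congr h) _ fun Z hZ ↦ ?_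
  rw [h.self_of_nhds]
  exact (hc.hasDerivAt_inner_field hW hZ).congr_of_eventuallyEq (h.mono fun s hs ↦ by simp [hs])

lemma IsLeviCivita.covDerivAlong_add (hV : SmoothAlongAt I γ V t) (hW : SmoothAlongAt I γ W t) :
    covDerivAlong conn γ (fun s ↦ V s + W s) t
      = covDerivAlong conn γ V t + covDerivAlong conn γ W t := by
  refine hc.covDerivAlong_eq_of_inner (hV.add hW) _ fun Z hZ ↦ ?_
  simp only [inner_add_left]
  exact ((hc.hasDerivAt_inner_field hV hZ).add (hc.hasDerivAt_inner_field hW hZ)).congr_deriv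
    (by ring)

lemma IsLeviCivita.covDerivAlong_smul {f : ℝ → ℝ} (hf : ContDiffAt ℝ ∞ f t)
    (hV : SmoothAlongAt I γ V t) :
    covDerivAlong conn γ (fun s ↦ f s • V s) t
      = deriv f t • V t + f t • covDerivAlong conn γ V t := by
  refine hc.covDerivAlong_eq_of_inner (hV.smul hf) _ fun Z hZ ↦ ?_
  simp only [inner_add_left, inner_smul_left, RCLike.conj_to_real]
  exact ((hf.differentiableAt (by simp)).hasDerivAt.mul
    (hc.hasDerivAt_inner_field hV hZ)).congr_deriv (by ring)

omit hc

variable {φ : Π x : M, TangentSpace I x →L[ℝ] TangentSpace I x} {ξ : Π x : M, TangentSpace I x}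
  {η : Π x : M, TangentSpace I x →L[ℝ] ℝ}

/-- Expand `W` in a local frame and apply the Sasakian identity to each frame field; this is the
product rule together with `(∇_T φ) W`. -/
lemma IsSasakian.hasDerivAt_inner_φ (h : IsSasakian conn φ ξ η) (hc : IsLeviCivita conn)
    (hV : SmoothAlongAt I γ V t) (hW : SmoothAlongAt I γ W t) :
    HasDerivAt (fun s ↦ (inner ℝ (V s) (φ (γ s) (W s)) : ℝ))
      (inner ℝ (covDerivAlong conn γ V t) (φ (γ t) (W t))
        + inner ℝ (V t) (φ (γ t) (covDerivAlong conn γ W t)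
          + (inner ℝ (velocity I γ t) (W t) : ℝ) • ξ (γ t) - η (γ t) (W t) • velocity I γ t)) t := by
  obtain ⟨n, X, c, hX, hcs, hWX, hD⟩ := hW.exists_expansion (conn := conn)
  have h2 := HasDerivAt.fun_sum (u := Finset.univ) fun i _ ↦
    ((hcs i).differentiableAt (by simp)).hasDerivAt.mul
      (hc.hasDerivAt_inner_field hV (h.smooth_φ_apply (hX i)))
  have h3 : (fun s ↦ (inner ℝ (V s) (φ (γ s) (W s)) : ℝ)) =ᶠ[𝓝 t]
      fun s ↦ ∑ i, (c i * fun s ↦ (inner ℝ (V s) (φ (γ s) (X i (γ s))) : ℝ)) s := by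
    filter_upwards [hWX] with s hs
    rw [hs, map_sum, inner_sum]
    simp only [map_smul, inner_smul_right, Pi.mul_apply]
  refine (h2.congr_of_eventuallyEq h3).congr_deriv ?_
  rw [hD, hWX.self_of_nhds]
  simp only [map_sum, inner_sum, inner_sub_right, inner_add_right, inner_smul_right, map_add,
    map_smul, Finset.sum_mul, ← Finset.sum_add_distrib, ← Finset.sum_sub_distrib, smul_eq_mul]
  refine Finset.sum_congr rfl fun i _ ↦ ?_
  have := h.nabla_φ (γ t) (velocity I γ t) (X i) (mdiffAt_of_smooth (hX i))
  rw [sub_eq_iff_eq_add] at this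
  rw [this]
  simp only [inner_sub_right, inner_add_right, inner_smul_right]
  ring

end metric

end along

/-! ### The differential system that forces `η(T)` to be constant. -/

lemma eq_of_hasDerivAt_zero {J : Set ℝ} (hJ : IsOpen J) (hJ' : J.OrdConnected) {f : ℝ → ℝ}
    (hf : ∀ t ∈ J, HasDerivAt f 0 t) {s t : ℝ} (hs : s ∈ J) (ht : t ∈ J) : f s = f t :=
  hJ.is_const_of_deriv_eq_zero hJ'.isPreconnected
    (fun x hx ↦ (hf x hx).differentiableAt.differentiableWithinAt) (fun x hx ↦ (hf x hx).deriv)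
    hs ht

/-- If `f` equals `g` on an open set then they have the same derivatives there. -/
lemma hasDerivAt_unique_of_eqOn {J : Set ℝ} (hJ : IsOpen J) {f g : ℝ → ℝ} (h : EqOn f g J)
    {a b t : ℝ} (ht : t ∈ J) (hf : HasDerivAt f a t) (hg : HasDerivAt g b t) : a = b :=
  hf.unique (hg.congr_of_eventuallyEq (h.eventuallyEq_of_mem (hJ.mem_nhds ht)))

/-- The system satisfied by the curvature `k`, the components `f, a, b` of a Frenet frame along the
characteristic field and the square norm `n` forces `a` to vanish. -/
lemma normal_component_eq_zero {J : Set ℝ} (hJ : IsOpen J) {C : ℝ} (hC : C ≠ 0)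
    {k f a b n : ℝ → ℝ} (hk : ∀ t ∈ J, 0 < k t) (hk' : ∀ t ∈ J, HasDerivAt k 0 t)
    (hf : ∀ t ∈ J, HasDerivAt f (k t * a t) t)
    (ha : ∀ t ∈ J, HasDerivAt a (-(k t * f t) + b t) t)
    (hb : ∀ t ∈ J, HasDerivAt b (a t * (-n t - C * a t ^ 2 - C * f t ^ 2 + C + 1)) t)
    (hn : ∀ t ∈ J, HasDerivAt n (2 * C * a t * b t) t)
    (h : ∀ t ∈ J, k t ^ 2 + n t + C * f t ^ 2 + C * a t ^ 2 = C + 1) {t : ℝ} (ht : t ∈ J) :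
    a t = 0 := by
  -- Differentiate the conserved relation `h`: the `k f a` terms cancel, leaving `4 C a b = 0`.
  have hab : ∀ s ∈ J, a s * b s = 0 := by
    intro s hs
    have h1 := ((((hk' s hs).fun_pow 2).fun_add (hn s hs)).fun_add
      (((hf s hs).fun_pow 2).const_mul C)).fun_add (((ha s hs).fun_pow 2).const_mul C)
    have h2 := hasDerivAt_unique_of_eqOn hJ (g := fun _ ↦ C + 1) h hs h1 (hasDerivAt_const s _)
    have h3 : (4 * C) * (a s * b s) = 0 := by
      norm_num at h2
      linarith
    exact (mul_eq_zero.1 h3).resolve_left (by simpa using hC)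
  by_contra hat
  -- Vanishing on a whole neighbourhood is needed, so that `b' = 0` at `t`; the bracket in `hb` then
  -- vanishes and `h` leaves `k² = 0`.
  have hev : ∀ᶠ s in nhds t, b s = 0 := by
    filter_upwards [(ha t ht).continuousAt.eventually_ne hat, hJ.mem_nhds ht] with s h1 h2
    exact (mul_eq_zero.1 (hab s h2)).resolve_left h1
  have h1 := (hb t ht).unique ((hasDerivAt_const t (0 : ℝ)).congr_of_eventuallyEq hev)
  have h2 := (mul_eq_zero.1 h1).resolve_left hat
  have h3 : k t ^ 2 = 0 := by linarith [h t ht]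
  exact (hk t ht).ne' (by simpa using h3)

/-! ### The bitension field in terms of `T`, `P`, `B` and `ξ`. -/

section frame

open FiberBundle VectorField Filter Topology

variable {E : Type*} [NormedAddCommGroup E] [NormedSpace ℝ E] [FiniteDimensional ℝ E]
  [CompleteSpace E]
  {H : Type*} [TopologicalSpace H] {I : ModelWithCorners ℝ E H}
  {M : Type*} [TopologicalSpace M] [ChartedSpace H M] [IsManifold I ∞ M]
  {conn : CovariantDerivative I E (TangentSpace I : M → Type _)}
  [RiemannianBundle (fun x : M ↦ TangentSpace I x)]
  {φ : Π x : M, TangentSpace I x →L[ℝ] TangentSpace I x} {ξ : Π x : M, TangentSpace I x}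
  {η : Π x : M, TangentSpace I x →L[ℝ] ℝ} {c : ℝ}
  {γ : ℝ → M} {J : Set ℝ} {T P B : Π t : ℝ, TangentSpace I (γ t)} {k : ℝ → ℝ} {t : ℝ}

/-- `T` is the unit velocity of `γ`, `P` its principal normal, `k > 0` its curvature and `B` the
component of `∇_T P` orthogonal to `T`; moreover `P` is orthogonal to `φ T`. -/
structure IsFrenetTriple (conn : CovariantDerivative I E (TangentSpace I : M → Type _))
    (φ : Π x : M, TangentSpace I x →L[ℝ] TangentSpace I x) (γ : ℝ → M) (J : Set ℝ)
    (T P B : Π t : ℝ, TangentSpace I (γ t)) (k : ℝ → ℝ) : Prop where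
  isOpen : IsOpen J
  smooth_T : ∀ t ∈ J, SmoothAlongAt I γ T t
  smooth_P : ∀ t ∈ J, SmoothAlongAt I γ P t
  smooth_B : ∀ t ∈ J, SmoothAlongAt I γ B t
  smooth_k : ∀ t ∈ J, ContDiffAt ℝ ∞ k t
  pos : ∀ t ∈ J, 0 < k t
  velocity : ∀ t ∈ J, velocity I γ t = T t
  cov_T : ∀ t ∈ J, covDerivAlong conn γ T t = k t • P t
  cov_P : ∀ t ∈ J, covDerivAlong conn γ P t = -(k t • T t) + B t
  inner_T_T : ∀ t ∈ J, (inner ℝ (T t) (T t) : ℝ) = 1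
  inner_P_P : ∀ t ∈ J, (inner ℝ (P t) (P t) : ℝ) = 1
  inner_P_T : ∀ t ∈ J, (inner ℝ (P t) (T t) : ℝ) = 0
  inner_B_T : ∀ t ∈ J, (inner ℝ (B t) (T t) : ℝ) = 0
  inner_B_P : ∀ t ∈ J, (inner ℝ (B t) (P t) : ℝ) = 0
  perp : ∀ t ∈ J, (inner ℝ (P t) (φ (γ t) (T t)) : ℝ) = 0

variable [T2Space M] [IsContMDiffRiemannianBundle I ∞ E (fun x : M ↦ TangentSpace I x)]

namespace IsFrenetTriple

variable (h : IsFrenetTriple conn φ γ J T P B k) (hc : IsLeviCivita conn)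
  (hN : IsSasakianSpaceForm conn φ ξ η c)

include h

lemma eventually_mem (ht : t ∈ J) : ∀ᶠ s in 𝓝 t, s ∈ J := h.isOpen.mem_nhds ht

lemma differentiableAt_k (ht : t ∈ J) : HasDerivAt k (deriv k t) t :=
  ((h.smooth_k t ht).differentiableAt (by simp)).hasDerivAt

include hc

lemma tension_eq (ht : t ∈ J) : tension conn γ t = k t • P t := by
  rw [← h.cov_T t ht]
  exact hc.covDerivAlong_congr (h.smooth_T t ht) ((h.eventually_mem ht).mono h.velocity)

lemma cov_tension (ht : t ∈ J) : covDerivAlong conn γ (tension conn γ) t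
    = deriv k t • P t + (-(k t ^ 2)) • T t + k t • B t := by
  rw [hc.covDerivAlong_congr ((h.smooth_P t ht).smul (h.smooth_k t ht))
    ((h.eventually_mem ht).mono fun s hs ↦ h.tension_eq hc hs),
    hc.covDerivAlong_smul (h.smooth_k t ht) (h.smooth_P t ht), h.cov_P t ht]
  module

lemma cov_cov_tension (ht : t ∈ J) :
    covDerivAlong conn γ (covDerivAlong conn γ (tension conn γ)) t
      = (deriv (deriv k) t - k t ^ 3) • P t - (3 * k t * deriv k t) • T t
        + (2 * deriv k t) • B t + k t • covDerivAlong conn γ B t := by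
  have hk := h.smooth_k t ht
  have hk' : ContDiffAt ℝ ∞ (deriv k) t := hk.derivWithin (by simp)
  have hk2 : ContDiffAt ℝ ∞ (fun s ↦ -(k s ^ 2)) t := (hk.pow 2).neg
  have e1 := (h.smooth_P t ht).smul hk'
  have e2 := (h.smooth_T t ht).smul hk2
  have e3 := (h.smooth_B t ht).smul hk
  have hd : deriv (fun s ↦ -(k s ^ 2)) t = -(2 * k t * deriv k t) := by
    simpa using ((h.differentiableAt_k ht).fun_pow 2).fun_neg.deriv
  rw [hc.covDerivAlong_congr ((e1.add e2).add e3)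
    ((h.eventually_mem ht).mono fun s hs ↦ h.cov_tension hc hs),
    hc.covDerivAlong_add (e1.add e2) e3, hc.covDerivAlong_add e1 e2,
    hc.covDerivAlong_smul hk' (h.smooth_P t ht), hc.covDerivAlong_smul hk2 (h.smooth_T t ht),
    hc.covDerivAlong_smul hk (h.smooth_B t ht), h.cov_P t ht, h.cov_T t ht, hd]
  module

lemma hasDerivAt_inner_B_B (ht : t ∈ J) : HasDerivAt (fun s ↦ (inner ℝ (B s) (B s) : ℝ))
    (2 * inner ℝ (covDerivAlong conn γ B t) (B t)) t :=
  (hc.hasDerivAt_inner_along (h.smooth_B t ht) (h.smooth_B t ht)).congr_deriv (by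
    rw [real_inner_comm (B t)]; ring)

lemma inner_cov_B_T (ht : t ∈ J) : (inner ℝ (covDerivAlong conn γ B t) (T t) : ℝ) = 0 := by
  have h1 := hasDerivAt_unique_of_eqOn h.isOpen (g := fun _ ↦ (0 : ℝ)) h.inner_B_T ht
    (hc.hasDerivAt_inner_along (h.smooth_B t ht) (h.smooth_T t ht)) (hasDerivAt_const t _)
  rw [h.cov_T t ht, inner_smul_right, h.inner_B_P t ht] at h1
  linarith

lemma inner_cov_B_P (ht : t ∈ J) :
    (inner ℝ (covDerivAlong conn γ B t) (P t) : ℝ) = - inner ℝ (B t) (B t) := by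
  have h1 := hasDerivAt_unique_of_eqOn h.isOpen (g := fun _ ↦ (0 : ℝ)) h.inner_B_P ht
    (hc.hasDerivAt_inner_along (h.smooth_B t ht) (h.smooth_P t ht)) (hasDerivAt_const t _)
  rw [h.cov_P t ht, inner_add_right, inner_neg_right, inner_smul_right, h.inner_B_T t ht] at h1
  linarith

include hN

lemma hasDerivAt_inner_ξ {V : Π t : ℝ, TangentSpace I (γ t)} (hV : SmoothAlongAt I γ V t)
    (ht : t ∈ J) : HasDerivAt (fun s ↦ (inner ℝ (V s) (ξ (γ s)) : ℝ))
      (inner ℝ (covDerivAlong conn γ V t) (ξ (γ t)) - inner ℝ (V t) (φ (γ t) (T t))) t := by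
  refine (hc.hasDerivAt_inner_field hV hN.smooth_ξ).congr_deriv ?_
  rw [hN.conn_ξ hc, h.velocity t ht, inner_neg_right]
  ring

omit hc in
lemma inner_φ_self (V : TangentSpace I (γ t)) : (inner ℝ V (φ (γ t) V) : ℝ) = 0 := by
  have := hN.inner_φ_left (γ t) V V
  rw [real_inner_comm] at this
  linarith

lemma hasDerivAt_T_ξ (ht : t ∈ J) : HasDerivAt (fun s ↦ (inner ℝ (T s) (ξ (γ s)) : ℝ))
    (k t * inner ℝ (P t) (ξ (γ t))) t := by
  refine (h.hasDerivAt_inner_ξ hc hN (h.smooth_T t ht) ht).congr_deriv ?_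
  rw [h.cov_T t ht, h.inner_φ_self hN, inner_smul_left, RCLike.conj_to_real, sub_zero]

lemma hasDerivAt_P_ξ (ht : t ∈ J) : HasDerivAt (fun s ↦ (inner ℝ (P s) (ξ (γ s)) : ℝ))
    (-(k t * inner ℝ (T t) (ξ (γ t))) + inner ℝ (B t) (ξ (γ t))) t := by
  refine (h.hasDerivAt_inner_ξ hc hN (h.smooth_P t ht) ht).congr_deriv ?_
  rw [h.cov_P t ht, h.perp t ht, inner_add_left, inner_neg_left, inner_smul_left,
    RCLike.conj_to_real, sub_zero]

/-- Differentiating `⟨P, φT⟩ = 0`, the terms `⟨T, φT⟩` and `⟨P, φP⟩` drop out, and the Sasakian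
correction contributes `⟨P, ξ⟩`. -/
lemma inner_B_φ_T (ht : t ∈ J) :
    (inner ℝ (B t) (φ (γ t) (T t)) : ℝ) = - inner ℝ (P t) (ξ (γ t)) := by
  have h1 := hasDerivAt_unique_of_eqOn h.isOpen (g := fun _ ↦ (0 : ℝ)) h.perp ht
    (hN.hasDerivAt_inner_φ hc (h.smooth_P t ht) (h.smooth_T t ht)) (hasDerivAt_const t _)
  rw [h.cov_P t ht, h.cov_T t ht, h.velocity t ht, h.inner_T_T t ht] at h1
  simp only [inner_add_left, inner_neg_left, inner_smul_left, RCLike.conj_to_real, inner_sub_right,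
    inner_add_right, inner_smul_right, map_smul, h.inner_φ_self hN, h.inner_P_T t ht] at h1
  linarith

lemma hasDerivAt_B_ξ (ht : t ∈ J) : HasDerivAt (fun s ↦ (inner ℝ (B s) (ξ (γ s)) : ℝ))
    (inner ℝ (covDerivAlong conn γ B t) (ξ (γ t)) + inner ℝ (P t) (ξ (γ t))) t := by
  refine (h.hasDerivAt_inner_ξ hc hN (h.smooth_B t ht) ht).congr_deriv ?_
  rw [h.inner_B_φ_T hc hN ht]
  ring

/-- The orthogonality `P ⊥ φT` removes all `φ`-terms of the model tensor. -/
lemma curvature_eq (ht : t ∈ J) : curvature conn (γ t) (T t) (P t) (T t)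
    = (-((c + 3) / 4) + (c - 1) / 4 * inner ℝ (T t) (ξ (γ t)) ^ 2) • P t
      + ((c - 1) / 4 * inner ℝ (P t) (ξ (γ t))) • (ξ (γ t) - (inner ℝ (T t) (ξ (γ t)) : ℝ) • T t) := by
  refine ext_inner_right ℝ fun z ↦ ?_
  rw [hN.inner_curvature hc, spaceFormTensor]
  have h1 : (inner ℝ (T t) (φ (γ t) (P t)) : ℝ) = 0 := by
    rw [real_inner_comm, hN.inner_φ_left, h.perp t ht, neg_zero]
  rw [h1, h.inner_φ_self hN, real_inner_comm, h.inner_P_T t ht, h.inner_T_T t ht]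
  simp only [inner_add_left, inner_sub_left, inner_smul_left, RCLike.conj_to_real]
  rw [real_inner_comm z (T t), real_inner_comm z (ξ (γ t))]
  ring

lemma bitension_eq (ht : t ∈ J) : bitension conn γ t
      = (deriv (deriv k) t - k t ^ 3
          + k t * ((c + 3) / 4 - (c - 1) / 4 * inner ℝ (T t) (ξ (γ t)) ^ 2)) • P t
        - (3 * k t * deriv k t) • T t
        + (2 * deriv k t) • B t + k t • covDerivAlong conn γ B t
        - (k t * ((c - 1) / 4 * inner ℝ (P t) (ξ (γ t)))) •
          (ξ (γ t) - (inner ℝ (T t) (ξ (γ t)) : ℝ) • T t) := by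
  have hsm : curvature conn (γ t) (T t) (k t • P t) (T t)
      = k t • curvature conn (γ t) (T t) (P t) (T t) := by
    refine ext_inner_right ℝ fun z ↦ ?_
    rw [inner_smul_left, hN.inner_curvature hc, hN.inner_curvature hc, spaceFormTensor,
      spaceFormTensor]
    simp only [map_smul, inner_smul_left, inner_smul_right, RCLike.conj_to_real]
    ring
  rw [bitension, h.cov_cov_tension hc ht, h.tension_eq hc ht, h.velocity t ht, hsm,
    h.curvature_eq hc hN ht]
  module

end IsFrenetTriple

end frame

/-! ### Consequences of biharmonicity, and the characterization for Frenet curves. -/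

section curve

open FiberBundle VectorField Filter Topology

variable {E : Type*} [NormedAddCommGroup E] [NormedSpace ℝ E] [FiniteDimensional ℝ E]
  [CompleteSpace E]
  {H : Type*} [TopologicalSpace H] {I : ModelWithCorners ℝ E H}
  {M : Type*} [TopologicalSpace M] [ChartedSpace H M] [IsManifold I ∞ M]
  {conn : CovariantDerivative I E (TangentSpace I : M → Type _)}
  [RiemannianBundle (fun x : M ↦ TangentSpace I x)]
  {φ : Π x : M, TangentSpace I x →L[ℝ] TangentSpace I x} {ξ : Π x : M, TangentSpace I x}
  {η : Π x : M, TangentSpace I x →L[ℝ] ℝ} {c : ℝ}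
  {γ : ℝ → M} {J : Set ℝ} {T P B V W : Π t : ℝ, TangentSpace I (γ t)} {k : ℝ → ℝ} {t : ℝ}
  [T2Space M] [IsContMDiffRiemannianBundle I ∞ E (fun x : M ↦ TangentSpace I x)]

namespace IsFrenetTriple

variable (h : IsFrenetTriple conn φ γ J T P B k) (hc : IsLeviCivita conn)
  (hN : IsSasakianSpaceForm conn φ ξ η c)

include h hc hN

lemma bitension_eq_zero_of_const (hk : ∀ t ∈ J, HasDerivAt k 0 t) (ht : t ∈ J)
    (ha : (inner ℝ (P t) (ξ (γ t)) : ℝ) = 0) {n : ℝ}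
    (hB : covDerivAlong conn γ B t = (-n) • P t)
    (hn : k t ^ 2 + n = (c + 3) / 4 - (c - 1) / 4 * inner ℝ (T t) (ξ (γ t)) ^ 2) :
    bitension conn γ t = 0 := by
  have hk2 : deriv (deriv k) t = 0 :=
    ((hasDerivAt_const t (0 : ℝ)).congr_of_eventuallyEq
      ((h.eventually_mem ht).mono fun s hs ↦ (hk s hs).deriv)).deriv
  rw [h.bitension_eq hc hN ht, (hk t ht).deriv, hk2, ha, hB, ← hn]
  module

lemma hasDerivAt_k_of_bitension (ht : t ∈ J) (hb : bitension conn γ t = 0) :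
    HasDerivAt k 0 t := by
  have h1 := congrArg (fun v ↦ (inner ℝ v (T t) : ℝ)) (h.bitension_eq hc hN ht)
  simp only [hb, inner_zero_left, inner_add_left, inner_sub_left, inner_smul_left,
    RCLike.conj_to_real, h.inner_T_T t ht, h.inner_P_T t ht, h.inner_B_T t ht,
    h.inner_cov_B_T hc ht, real_inner_comm (T t) (ξ (γ t))] at h1
  have h2 : k t * deriv k t = 0 := by linarith
  have h3 := h.differentiableAt_k ht
  rwa [(mul_eq_zero.1 h2).resolve_left (h.pos t ht).ne'] at h3

lemma sq_add_inner_of_bitension (hb : ∀ t ∈ J, bitension conn γ t = 0) (ht : t ∈ J) :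
    k t ^ 2 + (inner ℝ (B t) (B t) : ℝ) + (c - 1) / 4 * inner ℝ (T t) (ξ (γ t)) ^ 2
      + (c - 1) / 4 * inner ℝ (P t) (ξ (γ t)) ^ 2 = (c - 1) / 4 + 1 := by
  have hk := fun s hs ↦ h.hasDerivAt_k_of_bitension hc hN (t := s) hs (hb s hs)
  have hk2 : deriv (deriv k) t = 0 :=
    ((hasDerivAt_const t (0 : ℝ)).congr_of_eventuallyEq
      ((h.eventually_mem ht).mono fun s hs ↦ (hk s hs).deriv)).deriv
  have h1 := congrArg (fun v ↦ (inner ℝ v (P t) : ℝ)) (h.bitension_eq hc hN ht)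
  simp only [hb t ht, inner_zero_left, inner_add_left, inner_sub_left, inner_smul_left,
    RCLike.conj_to_real, h.inner_P_P t ht, h.inner_B_P t ht, (hk t ht).deriv, hk2,
    h.inner_cov_B_P hc ht, real_inner_comm (P t) (ξ (γ t)), real_inner_comm (P t) (T t),
    h.inner_P_T t ht] at h1
  have h2 : k t * (k t ^ 2 + (inner ℝ (B t) (B t) : ℝ)
      + (c - 1) / 4 * inner ℝ (T t) (ξ (γ t)) ^ 2
      + (c - 1) / 4 * inner ℝ (P t) (ξ (γ t)) ^ 2 - ((c - 1) / 4 + 1)) = 0 := by linarith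
  linarith [(mul_eq_zero.1 h2).resolve_left (h.pos t ht).ne']

/-- With `k' = 0` and the `P`-component substituted, the biharmonic equation is `k` times an
equation that can be solved for `∇_T B`. -/
lemma cov_B_of_bitension (hb : ∀ t ∈ J, bitension conn γ t = 0) (ht : t ∈ J) :
    covDerivAlong conn γ B t
      = (-(inner ℝ (B t) (B t) : ℝ) - (c - 1) / 4 * inner ℝ (P t) (ξ (γ t)) ^ 2) • P t
        + ((c - 1) / 4 * inner ℝ (P t) (ξ (γ t))) •
          (ξ (γ t) - (inner ℝ (T t) (ξ (γ t)) : ℝ) • T t) := by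
  have hk := fun s hs ↦ h.hasDerivAt_k_of_bitension hc hN (t := s) hs (hb s hs)
  have hk2 : deriv (deriv k) t = 0 :=
    ((hasDerivAt_const t (0 : ℝ)).congr_of_eventuallyEq
      ((h.eventually_mem ht).mono fun s hs ↦ (hk s hs).deriv)).deriv
  have h1 := h.bitension_eq hc hN ht
  rw [hb t ht, (hk t ht).deriv, hk2] at h1
  have h2 := h.sq_add_inner_of_bitension hc hN hb ht
  refine smul_right_injective _ (h.pos t ht).ne' ?_
  have h3 : (c + 3) / 4 - (c - 1) / 4 * (inner ℝ (T t) (ξ (γ t)) : ℝ) ^ 2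
      = k t ^ 2 + inner ℝ (B t) (B t) + (c - 1) / 4 * inner ℝ (P t) (ξ (γ t)) ^ 2 := by linarith
  rw [h3] at h1
  simp only
  rw [← sub_eq_zero, h1]
  module

lemma inner_P_ξ_of_bitension (hc1 : c ≠ 1) (hb : ∀ t ∈ J, bitension conn γ t = 0) (ht : t ∈ J) :
    (inner ℝ (P t) (ξ (γ t)) : ℝ) = 0 := by
  have hC : (c - 1) / 4 ≠ 0 := div_ne_zero (sub_ne_zero.2 hc1) (by norm_num)
  refine normal_component_eq_zero h.isOpen hC h.pos
    (fun s hs ↦ h.hasDerivAt_k_of_bitension hc hN hs (hb s hs))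
    (fun s hs ↦ h.hasDerivAt_T_ξ hc hN hs) (fun s hs ↦ h.hasDerivAt_P_ξ hc hN hs)
    (fun s hs ↦ (h.hasDerivAt_B_ξ hc hN hs).congr_deriv ?_)
    (fun s hs ↦ (h.hasDerivAt_inner_B_B hc hs).congr_deriv ?_)
    (fun s hs ↦ h.sq_add_inner_of_bitension hc hN hb hs) ht
  · rw [h.cov_B_of_bitension hc hN hb hs]
    simp only [inner_add_left, inner_sub_left, inner_smul_left, RCLike.conj_to_real, hN.inner_ξ_ξ]
    ring
  · rw [h.cov_B_of_bitension hc hN hb hs]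
    simp only [inner_add_left, inner_sub_left, inner_smul_left, RCLike.conj_to_real,
      real_inner_comm (B s) (P s), real_inner_comm (B s) (T s), h.inner_B_P s hs, h.inner_B_T s hs,
      real_inner_comm (B s) (ξ (γ s))]
    ring

/-- Equality in Cauchy–Schwarz would give `T = f ξ` at `t`. Then `⟨B,T⟩ = 0` reads `f b = 0`, while
`a = 0` along the curve gives `b = k f`; hence `k f² = 0` with `f² = 1`, contradicting `k > 0`. -/
lemma inner_T_ξ_sq_lt_one_of_bitension (hc1 : c ≠ 1) (hb : ∀ t ∈ J, bitension conn γ t = 0)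
    (ht : t ∈ J) : (inner ℝ (T t) (ξ (γ t)) : ℝ) ^ 2 < 1 := by
  set f : ℝ := inner ℝ (T t) (ξ (γ t)) with hf
  have h1 : (inner ℝ (T t - f • ξ (γ t)) (T t - f • ξ (γ t)) : ℝ) = 1 - f ^ 2 := by
    simp only [inner_sub_left, inner_sub_right, inner_smul_left, inner_smul_right,
      RCLike.conj_to_real, h.inner_T_T t ht, hN.inner_ξ_ξ, real_inner_comm (T t) (ξ (γ t)), ← hf]
    ring
  have h2 : 0 ≤ 1 - f ^ 2 := h1 ▸ real_inner_self_nonneg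
  refine lt_of_le_of_ne (by linarith) fun h3 ↦ ?_
  rw [h3, sub_self, inner_self_eq_zero, sub_eq_zero] at h1
  have h4 := hasDerivAt_unique_of_eqOn h.isOpen (g := fun _ ↦ (0 : ℝ))
    (fun s hs ↦ h.inner_P_ξ_of_bitension hc hN hc1 hb hs) ht (h.hasDerivAt_P_ξ hc hN ht)
    (hasDerivAt_const t _)
  have h5 := h.inner_B_T t ht
  rw [h1, inner_smul_right] at h5
  have h6 : k t * f ^ 2 = 0 := by
    rw [← hf] at h4
    linear_combination (-f) * h4 + h5
  rw [h3, mul_one] at h6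
  exact (h.pos t ht).ne' h6

end IsFrenetTriple

variable (hc : IsLeviCivita conn)

include hc in
-- The function is `⟨V,X⟩' - ⟨V, ∇_T X⟩`, and both terms are visibly smooth. It serves to derive
-- smoothness of the curvatures `κ 1` and `κ 2` from that of the frame.
lemma IsLeviCivita.contDiffAt_inner_cov (hV : ∀ᶠ s in 𝓝 t, SmoothAlongAt I γ V s)
    (hT : SmoothAlongAt I γ T t) (hv : ∀ᶠ s in 𝓝 t, velocity I γ s = T s)
    {X : Π x : M, TangentSpace I x} (hX : CMDiff ∞ (T% X)) :
    ContDiffAt ℝ ∞ (fun s ↦ (inner ℝ (covDerivAlong conn γ V s) (X (γ s)) : ℝ)) t := by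
  have hγ := (smoothAlongAt_iff.1 hT).1
  have h1 : SmoothAlongAt I γ (fun s ↦ conn X (γ s) (T s)) t := by
    have := hc.smooth.contMDiff.contMDiff (σ := X) hX.contMDiffOn
    rw [contMDiffOn_univ] at this
    exact (this.contMDiffAt.comp t hγ).clm_bundle_apply hT
  have hXγ : SmoothAlongAt I γ (fun s ↦ X (γ s)) t := SmoothAlongAt.comp hγ hX
  have h2 : ContDiffAt ℝ ∞ (deriv fun s ↦ (inner ℝ (V s) (X (γ s)) : ℝ)) t :=
    (hV.self_of_nhds.contDiffAt_inner hXγ).derivWithin (by simp)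
  refine (h2.sub (hV.self_of_nhds.contDiffAt_inner h1)).congr_of_eventuallyEq ?_
  filter_upwards [hV, hv] with s h3 h4
  rw [(hc.hasDerivAt_inner_field h3 hX).deriv, h4, add_sub_cancel_right]

/-- Choose `X` extending `W t`; then `⟨W,X⟩` is nonzero near `t` and can be divided out. -/
lemma contDiffAt_of_mul_inner {g : ℝ → ℝ} (hW : SmoothAlongAt I γ W t) (hWt : W t ≠ 0)
    (hg : ∀ X : Π x : M, TangentSpace I x, CMDiff ∞ (T% X) →
      ContDiffAt ℝ ∞ (fun s ↦ g s * (inner ℝ (W s) (X (γ s)) : ℝ)) t) : ContDiffAt ℝ ∞ g t := by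
  obtain ⟨u, -, -, hu⟩ := exists_smooth_extend (I := I) (γ t)
  obtain ⟨X, hX, hXt, -⟩ := hu (W t)
  have hXγ : SmoothAlongAt I γ (fun s ↦ X (γ s)) t :=
    SmoothAlongAt.comp (smoothAlongAt_iff.1 hW).1 hX
  have h1 := hW.contDiffAt_inner hXγ
  have h2 : (inner ℝ (W t) (X (γ t)) : ℝ) ≠ 0 := by
    rw [hXt]
    exact inner_self_ne_zero.2 hWt
  refine ((hg X hX).div h1 h2).congr_of_eventuallyEq ?_
  filter_upwards [h1.continuousAt.eventually_ne h2] with s hs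
  rw [Pi.div_apply, mul_div_cancel_right₀ _ hs]

namespace IsFrenetCurve

variable {r : ℕ} {F : ℕ → Π t : ℝ, TangentSpace I (γ t)} {κ : ℕ → ℝ → ℝ}
  (h : IsFrenetCurve conn γ J r F κ) (hJ : IsOpen J)

include h

lemma inner_self {i : ℕ} (hi : i ∈ Icc 1 r) (ht : t ∈ J) : (inner ℝ (F i t) (F i t) : ℝ) = 1 := by
  rw [h.orthonormal t ht i hi i hi, if_pos rfl]

lemma inner_ne {i j : ℕ} (hi : i ∈ Icc 1 r) (hj : j ∈ Icc 1 r) (hij : i ≠ j) (ht : t ∈ J) :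
    (inner ℝ (F i t) (F j t) : ℝ) = 0 := by
  rw [h.orthonormal t ht i hi j hj, if_neg hij]

lemma cov_one (hr : 2 ≤ r) (ht : t ∈ J) : covDerivAlong conn γ (F 1) t = κ 1 t • F 2 t := by
  rw [h.frenet t ht 1 ⟨le_rfl, by omega⟩, if_pos rfl, if_neg (by omega), zero_add]

lemma cov_two (hr : 2 ≤ r) (ht : t ∈ J) : covDerivAlong conn γ (F 2) t
    = -(κ 1 t • F 1 t) + if r = 2 then 0 else κ 2 t • F 3 t := by
  rw [h.frenet t ht 2 ⟨by norm_num, hr⟩]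
  simp [eq_comm]

include hJ

lemma smoothAlongAt {i : ℕ} (hi : i ∈ Icc 1 r) (ht : t ∈ J) : SmoothAlongAt I γ (F i) t :=
  (h.smooth_frame i hi).contMDiffAt (hJ.mem_nhds ht)

include hc

lemma contDiffAt_κ_one (hr : 2 ≤ r) (ht : t ∈ J) : ContDiffAt ℝ ∞ (κ 1) t := by
  have i1 : 1 ∈ Icc 1 r := ⟨le_rfl, by omega⟩
  have i2 : 2 ∈ Icc 1 r := ⟨by norm_num, hr⟩
  have hev : ∀ᶠ s in 𝓝 t, s ∈ J := hJ.mem_nhds ht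
  refine contDiffAt_of_mul_inner (h.smoothAlongAt hJ i2 ht) ?_ fun X hX ↦ ?_
  · exact inner_self_ne_zero (𝕜 := ℝ).1 (by rw [h.inner_self i2 ht]; norm_num)
  · refine (hc.contDiffAt_inner_cov (hev.mono fun s hs ↦ h.smoothAlongAt hJ i1 hs)
      (h.smoothAlongAt hJ i1 ht) (hev.mono fun s hs ↦ (h.tangent s hs).symm)
      hX).congr_of_eventuallyEq ?_
    filter_upwards [hev] with s hs
    rw [h.cov_one hr hs, inner_smul_left, RCLike.conj_to_real]

lemma contDiffAt_κ_two (hr : 3 ≤ r) (ht : t ∈ J) : ContDiffAt ℝ ∞ (κ 2) t := by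
  have i1 : 1 ∈ Icc 1 r := ⟨le_rfl, by omega⟩
  have i2 : 2 ∈ Icc 1 r := ⟨by norm_num, by omega⟩
  have i3 : 3 ∈ Icc 1 r := ⟨by norm_num, hr⟩
  have hev : ∀ᶠ s in 𝓝 t, s ∈ J := hJ.mem_nhds ht
  refine contDiffAt_of_mul_inner (h.smoothAlongAt hJ i3 ht) ?_ fun X hX ↦ ?_
  · exact inner_self_ne_zero (𝕜 := ℝ).1 (by rw [h.inner_self i3 ht]; norm_num)
  · have hγ := (smoothAlongAt_iff.1 (h.smoothAlongAt hJ i1 ht)).1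
    have hXγ : SmoothAlongAt I γ (fun s ↦ X (γ s)) t := SmoothAlongAt.comp hγ hX
    refine ((hc.contDiffAt_inner_cov (hev.mono fun s hs ↦ h.smoothAlongAt hJ i2 hs)
      (h.smoothAlongAt hJ i1 ht) (hev.mono fun s hs ↦ (h.tangent s hs).symm) hX).add
      ((h.contDiffAt_κ_one hc hJ (by omega) ht).mul
        ((h.smoothAlongAt hJ i1 ht).contDiffAt_inner hXγ))).congr_of_eventuallyEq ?_
    filter_upwards [hev] with s hs
    rw [h.cov_two (by omega) hs, if_neg (by omega), inner_add_left, inner_neg_left,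
      inner_smul_left, inner_smul_left, RCLike.conj_to_real, RCLike.conj_to_real]
    ring

/-- The Frenet triple of a Frenet curve which is not a geodesic. -/
lemma isFrenetTriple (hr : 2 ≤ r)
    (hp : ∀ t ∈ J, (inner ℝ (covDerivAlong conn γ (velocity I γ) t)
      (φ (γ t) (velocity I γ t)) : ℝ) = 0) :
    IsFrenetTriple conn φ γ J (F 1) (F 2)
      (fun s ↦ if r = 2 then 0 else κ 2 s • F 3 s) (κ 1) := by
  have i1 : 1 ∈ Icc 1 r := ⟨le_rfl, by omega⟩
  have i2 : 2 ∈ Icc 1 r := ⟨by norm_num, hr⟩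
  have hpos := h.curvature_pos 1 le_rfl (by omega)
  have hB : ∀ V : Π t : ℝ, TangentSpace I (γ t), (∀ t ∈ J, 3 ≤ r → (inner ℝ (F 3 t) (V t) : ℝ) = 0)
      → ∀ t ∈ J, (inner ℝ (if r = 2 then 0 else κ 2 t • F 3 t) (V t) : ℝ) = 0 := by
    intro V hV t ht
    split_ifs with h2
    · exact inner_zero_left _
    · rw [inner_smul_left, hV t ht (by omega), mul_zero]
  refine ⟨hJ, fun t ht ↦ h.smoothAlongAt hJ i1 ht, fun t ht ↦ h.smoothAlongAt hJ i2 ht,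
    fun t ht ↦ ?_, fun t ht ↦ h.contDiffAt_κ_one hc hJ hr ht, hpos,
    fun t ht ↦ (h.tangent t ht).symm, fun t ht ↦ h.cov_one hr ht, fun t ht ↦ h.cov_two hr ht,
    fun t ht ↦ h.inner_self i1 ht, fun t ht ↦ h.inner_self i2 ht,
    fun t ht ↦ h.inner_ne i2 i1 (by norm_num) ht,
    hB _ fun t ht h3 ↦ h.inner_ne ⟨by norm_num, h3⟩ i1 (by norm_num) ht,
    hB _ fun t ht h3 ↦ h.inner_ne ⟨by norm_num, h3⟩ i2 (by norm_num) ht, fun t ht ↦ ?_⟩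
  · split_ifs with h2
    · exact SmoothAlongAt.zero (smoothAlongAt_iff.1 (h.smoothAlongAt hJ i1 ht)).1
    · exact (h.smoothAlongAt hJ ⟨by norm_num, by omega⟩ ht).smul
        (h.contDiffAt_κ_two hc hJ (by omega) ht)
  · have h1 := hp t ht
    have h2 := hc.covDerivAlong_congr (conn := conn) (V := velocity I γ) (h.smoothAlongAt hJ i1 ht)
      (Filter.mem_of_superset (hJ.mem_nhds ht) fun s hs ↦ (h.tangent s hs).symm)
    rw [h2, ← h.tangent t ht, h.cov_one hr ht, inner_smul_left, RCLike.conj_to_real] at h1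
    exact (mul_eq_zero.1 h1).resolve_left (hpos t ht).ne'

lemma two_le_of_tension (hτ : ¬ ∀ t ∈ J, tension conn γ t = 0) : 2 ≤ r := by
  by_contra hr
  have hr1 : r = 1 := by have := h.one_le; omega
  refine hτ fun t ht ↦ ?_
  have i1 : 1 ∈ Icc 1 r := ⟨le_rfl, hr1.ge⟩
  have h1 := h.frenet t ht 1 i1
  rw [if_pos rfl, if_pos hr1.symm, add_zero] at h1
  rw [← h1]
  exact hc.covDerivAlong_congr (h.smoothAlongAt hJ i1 ht)
    (Filter.mem_of_superset (hJ.mem_nhds ht) fun s hs ↦ (h.tangent s hs).symm)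

omit hc in
lemma eventually_mem (ht : t ∈ J) : ∀ᶠ s in 𝓝 t, s ∈ J := hJ.mem_nhds ht

lemma cov_smul_three (hr : 3 ≤ r) (ht : t ∈ J) :
    covDerivAlong conn γ (fun s ↦ κ 2 s • F 3 s) t = deriv (κ 2) t • F 3 t
      + κ 2 t • (-(κ 2 t • F 2 t) + if 3 = r then 0 else κ 3 t • F 4 t) := by
  have i3 : 3 ∈ Icc 1 r := ⟨by norm_num, hr⟩
  rw [hc.covDerivAlong_smul (h.contDiffAt_κ_two hc hJ hr ht) (h.smoothAlongAt hJ i3 ht),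
    h.frenet t ht 3 i3]
  simp

/-- If there were a fourth Frenet field, its component in `∇_T(κ 2 • F 3)` would be `κ 2 κ 3 > 0`.
-/
lemma eq_three_of_cov (hr : 3 ≤ r) {a : ℝ} (ht : t ∈ J)
    (hB : covDerivAlong conn γ (fun s ↦ κ 2 s • F 3 s) t = a • F 2 t) : r = 3 := by
  by_contra h3
  have i4 : 4 ∈ Icc 1 r := ⟨by norm_num, by omega⟩
  rw [h.cov_smul_three hc hJ hr ht, if_neg (by omega)] at hB
  have h1 := congrArg (fun v ↦ (inner ℝ v (F 4 t) : ℝ)) hB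
  simp only [inner_add_left, inner_neg_left, inner_smul_left, RCLike.conj_to_real,
    h.inner_self i4 ht, h.inner_ne ⟨by norm_num, hr⟩ i4 (show (3 : ℕ) ≠ 4 by norm_num) ht,
    h.inner_ne ⟨by norm_num, by omega⟩ i4 (show (2 : ℕ) ≠ 4 by norm_num) ht] at h1
  have h2 := h.curvature_pos 2 (by norm_num) (by omega) t ht
  have h3 := h.curvature_pos 3 (by norm_num) (by omega) t ht
  nlinarith [mul_pos h2 h3]

variable (hp : ∀ t ∈ J, (inner ℝ (covDerivAlong conn γ (velocity I γ) t)
      (φ (γ t) (velocity I γ t)) : ℝ) = 0)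

include hp

theorem exists_angle_of_isProperBiharmonic (hN : IsSasakianSpaceForm conn φ ξ η c) (hc1 : c ≠ 1)
    (hJ' : J.OrdConnected) (hη : ∃ t ∈ J, η (γ t) (velocity I γ t) ≠ 0)
    (hb : IsProperBiharmonic conn γ J) :
    ∃ β ∈ Ioo 0 (2 * Real.pi) \ {Real.pi / 2, Real.pi, 3 * Real.pi / 2},
      0 < (c + 3) / 4 - (c - 1) / 4 * Real.cos β ^ 2 ∧
      (∀ t ∈ J, η (γ t) (velocity I γ t) = Real.cos β) ∧
      ((IsCircle J r κ ∧ ∀ t ∈ J, κ 1 t ^ 2 = (c + 3) / 4 - (c - 1) / 4 * Real.cos β ^ 2) ∨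
        (IsHelix J r κ ∧
          ∀ t ∈ J, κ 1 t ^ 2 + κ 2 t ^ 2 = (c + 3) / 4 - (c - 1) / 4 * Real.cos β ^ 2)) := by
  have hr := h.two_le_of_tension hc hJ hb.2
  have hT := h.isFrenetTriple hc hJ hr hp
  set B : Π t : ℝ, TangentSpace I (γ t) := fun s ↦ if r = 2 then 0 else κ 2 s • F 3 s with hB
  have ha := fun t ht ↦ hT.inner_P_ξ_of_bitension hc hN hc1 hb.1 (t := t) ht
  have hcB : ∀ t ∈ J, covDerivAlong conn γ B t = (-(inner ℝ (B t) (B t) : ℝ)) • F 2 t := by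
    intro t ht
    rw [hT.cov_B_of_bitension hc hN hb.1 ht, ha t ht]
    module
  have hk : ∀ t ∈ J, HasDerivAt (κ 1) 0 t :=
    fun t ht ↦ hT.hasDerivAt_k_of_bitension hc hN ht (hb.1 t ht)
  have hf : ∀ t ∈ J, HasDerivAt (fun s ↦ (inner ℝ (F 1 s) (ξ (γ s)) : ℝ)) 0 t :=
    fun t ht ↦ (hT.hasDerivAt_T_ξ hc hN ht).congr_deriv (by rw [ha t ht, mul_zero])
  have hn : ∀ t ∈ J, HasDerivAt (fun s ↦ (inner ℝ (B s) (B s) : ℝ)) 0 t := by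
    refine fun t ht ↦ (hT.hasDerivAt_inner_B_B hc ht).congr_deriv ?_
    rw [hcB t ht, inner_smul_left, real_inner_comm (B t) (F 2 t), hT.inner_B_P t ht]
    ring
  obtain ⟨t₀, ht₀, hη₀⟩ := hη
  have hηf : ∀ t ∈ J, η (γ t) (velocity I γ t) = inner ℝ (F 1 t) (ξ (γ t)) := by
    intro t ht
    rw [← h.tangent t ht, hN.η_eq]
  set f₀ : ℝ := inner ℝ (F 1 t₀) (ξ (γ t₀)) with hf₀
  have hff : ∀ t ∈ J, (inner ℝ (F 1 t) (ξ (γ t)) : ℝ) = f₀ := fun t ht ↦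
    eq_of_hasDerivAt_zero hJ hJ' hf ht ht₀
  have hlt := abs_lt.1 ((sq_lt_one_iff_abs_lt_one f₀).1
    (hT.inner_T_ξ_sq_lt_one_of_bitension hc hN hc1 hb.1 ht₀))
  -- The angle is `arccos f₀`, which lies in `(0, π)` as `f₀² < 1`, and differs from `π/2` as the
  -- curve is not Legendre.
  have hcos : Real.cos (Real.arccos f₀) = f₀ := Real.cos_arccos hlt.1.le hlt.2.le
  have hsum : ∀ t ∈ J, κ 1 t ^ 2 + (inner ℝ (B t) (B t) : ℝ)
      = (c + 3) / 4 - (c - 1) / 4 * f₀ ^ 2 := by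
    intro t ht
    have := hT.sq_add_inner_of_bitension hc hN hb.1 ht
    rw [ha t ht, hff t ht] at this
    linarith
  have hpi : Real.arccos f₀ < Real.pi := by
    refine lt_of_le_of_ne (Real.arccos_le_pi _) fun h1 ↦ ?_
    rw [h1, Real.cos_pi] at hcos
    linarith [hlt.1]
  have hpp := Real.pi_pos
  refine ⟨Real.arccos f₀, ⟨⟨Real.arccos_pos.2 hlt.2, by linarith⟩, ?_⟩, ?_, ?_, ?_⟩
  · rintro (h1 | h1 | h1)
    · rw [h1, Real.cos_pi_div_two] at hcos
      exact hη₀ ((hηf t₀ ht₀).trans hcos.symm)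
    · exact hpi.ne h1
    · have : Real.arccos f₀ = 3 * Real.pi / 2 := h1
      linarith
  · rw [hcos, ← hsum t₀ ht₀]
    exact add_pos_of_pos_of_nonneg (pow_pos (hT.pos t₀ ht₀) 2) real_inner_self_nonneg
  · intro t ht
    rw [hcos, hηf t ht, hff t ht]
  · rw [hcos]
    have hk1 : ∀ t ∈ J, κ 1 t = κ 1 t₀ := fun t ht ↦ eq_of_hasDerivAt_zero hJ hJ' hk ht ht₀
    rcases eq_or_ne r 2 with h2 | h2
    · refine Or.inl ⟨⟨h2, _, hk1⟩, fun t ht ↦ ?_⟩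
      rw [← hsum t ht]
      simp [hB, h2]
    · have h3 : 3 ≤ r := by omega
      have hB' : B = fun s ↦ κ 2 s • F 3 s := by simp [hB, h2]
      have hBB : ∀ t ∈ J, (inner ℝ (B t) (B t) : ℝ) = κ 2 t ^ 2 := by
        intro t ht
        rw [hB', inner_smul_left, inner_smul_right, h.inner_self ⟨by norm_num, h3⟩ ht,
          RCLike.conj_to_real]
        ring
      have hκ := h.curvature_pos 2 (by norm_num) (by omega)
      have hcB₀ := hcB t₀ ht₀
      rw [hB'] at hcB₀
      refine Or.inr ⟨⟨h.eq_three_of_cov hc hJ h3 ht₀ hcB₀, _, κ 2 t₀, fun t ht ↦ ⟨hk1 t ht, ?_⟩⟩,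
        fun t ht ↦ ?_⟩
      -- Only `κ 2 ^ 2 = |B|²` is known to be constant; positivity recovers `κ 2`.
      · refine (sq_eq_sq₀ (hκ t ht).le (hκ t₀ ht₀).le).1 ?_
        rw [← hBB t ht, ← hBB t₀ ht₀]
        exact eq_of_hasDerivAt_zero hJ hJ' hn ht ht₀
      · rw [← hsum t ht, hBB t ht]

theorem isProperBiharmonic_of_const (hN : IsSasakianSpaceForm conn φ ξ η c) {x : ℝ}
    (hJne : J.Nonempty) (hη : ∀ t ∈ J, η (γ t) (velocity I γ t) = x)
    (hκ : (IsCircle J r κ ∧ ∀ t ∈ J, κ 1 t ^ 2 = (c + 3) / 4 - (c - 1) / 4 * x ^ 2) ∨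
        (IsHelix J r κ ∧
          ∀ t ∈ J, κ 1 t ^ 2 + κ 2 t ^ 2 = (c + 3) / 4 - (c - 1) / 4 * x ^ 2)) :
    IsProperBiharmonic conn γ J := by
  have hr : 2 ≤ r := by
    rcases hκ with h1 | h1
    · exact h1.1.1.ge
    · have := h1.1.1
      omega
  have hT := h.isFrenetTriple hc hJ hr hp
  have hf : ∀ t ∈ J, (inner ℝ (F 1 t) (ξ (γ t)) : ℝ) = x := by
    intro t ht
    rw [← hN.η_eq, h.tangent t ht, hη t ht]
  have hconst : ∀ {g : ℝ → ℝ} {a : ℝ}, (∀ t ∈ J, g t = a) → ∀ t ∈ J, HasDerivAt g 0 t :=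
    fun hg t ht ↦ (hasDerivAt_const t _).congr_of_eventuallyEq
      ((h.eventually_mem hJ ht).mono hg)
  -- Constancy of `η(T)` together with `f' = k a` and `k > 0`.
  have ha : ∀ t ∈ J, (inner ℝ (F 2 t) (ξ (γ t)) : ℝ) = 0 := fun t ht ↦
    (mul_eq_zero.1 ((hT.hasDerivAt_T_ξ hc hN ht).unique (hconst hf t ht))).resolve_left
      (hT.pos t ht).ne'
  refine ⟨fun t ht ↦ ?_, fun h0 ↦ ?_⟩
  · rcases hκ with ⟨⟨h2, k₁, hk₁⟩, hsum⟩ | ⟨⟨h3, k₁, k₂, hk⟩, hsum⟩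
    · refine hT.bitension_eq_zero_of_const hc hN (hconst hk₁) ht (ha t ht) (n := 0) ?_ ?_
      -- For a circle `B` is the zero field, written as `0 • T` so that the product rule computes
      -- its covariant derivative.
      · have h0 := hc.covDerivAlong_smul (conn := conn) (f := fun _ ↦ 0) contDiffAt_const
          (hT.smooth_T t ht)
        simpa [h2] using h0
      · rw [hsum t ht, hf t ht, add_zero]
    · refine hT.bitension_eq_zero_of_const hc hN (hconst fun s hs ↦ (hk s hs).1) ht (ha t ht)
        (n := κ 2 t ^ 2) ?_ ?_
      · have h2 : r ≠ 2 := by omega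
        simp only [h2, if_false]
        rw [h.cov_smul_three hc hJ h3.ge ht, if_pos h3.symm,
          (hconst (fun s hs ↦ (hk s hs).2) t ht).deriv]
        module
      · rw [hsum t ht, hf t ht]
  · obtain ⟨t, ht⟩ := hJne
    have h1 := h0 t ht
    rw [hT.tension_eq hc ht] at h1
    have h2 := hT.inner_P_P t ht
    rw [(smul_eq_zero.1 h1).resolve_left (hT.pos t ht).ne', inner_zero_left] at h2
    exact zero_ne_one h2

end IsFrenetCurve

end curve

end Sasaki

end

theorem mainTheorem2 (n : ℕ) (hn : 2 ≤ n) {M : Type*} [TopologicalSpace M] [T2Space M]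
    [ChartedSpace (EuclideanSpace ℝ (Fin (2 * n + 1))) M] [IsManifold (𝓡 (2 * n + 1)) ∞ M]
    [RiemannianBundle (fun x : M ↦ TangentSpace (𝓡 (2 * n + 1)) x)]
    [IsContMDiffRiemannianBundle (𝓡 (2 * n + 1)) ∞ (EuclideanSpace ℝ (Fin (2 * n + 1)))
      (fun x : M ↦ TangentSpace (𝓡 (2 * n + 1)) x)]
    (conn : CovariantDerivative (𝓡 (2 * n + 1)) (EuclideanSpace ℝ (Fin (2 * n + 1)))
      (TangentSpace (𝓡 (2 * n + 1)) : M → Type _))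
    (hconn : Sasaki.IsLeviCivita conn)
    (φ : Π x : M, TangentSpace (𝓡 (2 * n + 1)) x →L[ℝ] TangentSpace (𝓡 (2 * n + 1)) x)
    (ξ : Π x : M, TangentSpace (𝓡 (2 * n + 1)) x)
    (η : Π x : M, TangentSpace (𝓡 (2 * n + 1)) x →L[ℝ] ℝ)
    (c : ℝ) (hN : Sasaki.IsSasakianSpaceForm conn φ ξ η c) (hc : c ≠ 1)
    (J : Set ℝ) (hJ_open : IsOpen J) (hJ_conn : J.OrdConnected)
    (γ : ℝ → M) (r : ℕ) (F : ℕ → Π t : ℝ, TangentSpace (𝓡 (2 * n + 1)) (γ t)) (κ : ℕ → ℝ → ℝ)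
    (hγ : Sasaki.IsFrenetCurve conn γ J r F κ)
    (h_nonLegendre : ∃ t ∈ J, η (γ t) (Sasaki.velocity (𝓡 (2 * n + 1)) γ t) ≠ 0)
    (h_perp : ∀ t ∈ J,
      inner ℝ (Sasaki.covDerivAlong conn γ (Sasaki.velocity (𝓡 (2 * n + 1)) γ) t)
        (φ (γ t) (Sasaki.velocity (𝓡 (2 * n + 1)) γ t)) = (0 : ℝ)) :
    Sasaki.IsProperBiharmonic conn γ J ↔
      ∃ β₀ ∈ Ioo 0 (2 * Real.pi) \ {Real.pi / 2, Real.pi, 3 * Real.pi / 2},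
        0 < (c + 3) / 4 - (c - 1) / 4 * Real.cos β₀ ^ 2 ∧
        (∀ t ∈ J, η (γ t) (Sasaki.velocity (𝓡 (2 * n + 1)) γ t) = Real.cos β₀) ∧
        ((Sasaki.IsCircle J r κ ∧
            ∀ t ∈ J, κ 1 t ^ 2 = (c + 3) / 4 - (c - 1) / 4 * Real.cos β₀ ^ 2) ∨
          (Sasaki.IsHelix J r κ ∧
            ∀ t ∈ J, κ 1 t ^ 2 + κ 2 t ^ 2
              = (c + 3) / 4 - (c - 1) / 4 * Real.cos β₀ ^ 2)) := by
  refine ⟨fun h ↦ hγ.exists_angle_of_isProperBiharmonic hconn hJ_open h_perp hN hc hJ_conn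
    h_nonLegendre h, ?_⟩
  rintro ⟨β₀, -, -, hη, hκ⟩
  obtain ⟨t, ht, -⟩ := h_nonLegendre
  exact hγ.isProperBiharmonic_of_const hconn hJ_open h_perp hN ⟨t, ht⟩ hη hκ
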